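/- Let $U$ be a semigroup, $A=\{a_1<\dots<a_r\}\subseteq U$ a finite ordered set, and $S=\langle A\rangle$. Let $A^+$ be the set of non-empty words over $A$ with the short-lex order $<$, and $\nu:A^+\to S$ the homomorphism extending the inclusion of $A$. A word $w$ is reduced if it is the least word with value $\nu(w)$. For a word $w$ let $f(w),l(w)$ be its first and last letter, and $s(w),p(w)$ the words obtained by deleting the first, respectively last, letter; for the empty word $\varepsilon$ put $\phi(a,\varepsilon)=a$. **Snapshots.** A snapshot of $S$ is a tuple $(A,Y,K,B,\phi)$ where: $A\subseteq Y=\{y_1<\dots<y_N\}$ consists of reduced words, and every reduced word is in $Y$ or greater than every element of $Y$; $1\le K\le N+1$; $B$ is an initial segment of $A$, possibly empty; and $\phi$ is a function from $(A\times\{y_1,\dots,y_L\})\cup(\{y_1,\dots,y_{K-1}\}\times A)\cup(\{y_K\}\times B)$ to $Y$ with $\nu(\phi(u,v))=\nu(uv)$ (the last set being empty if $K=N+1$), where $L=K-1$, or $L<K-1$ and $L$ is the largest value with $|y_L|<|y_{K-1}|$ ($L=0$ if there is none). Its size is $|Y|$. It is extended by $(A,Y',K',B',\phi')$ if $K\le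 K'$, $Y\subseteq Y'$ and $\phi'$ extends $\phi$. **Fragments.** A fragment for $S$ is a tuple $(A,Y,K,\phi)$ where: $Y=\{y_1<\dots<y_N\}$ consists of reduced words; $1\le K\le N+1$; if $K>1$, then $y_{K-1}$ is the greatest word of its length in $Y$; and $\phi$ is a function from $(A\times\{y_1,\dots,y_L\})\cup(\{y_1,\dots,y_{K-1}\}\times A)$ to the set of reduced words with $\nu(\phi(u,v))=\nu(uv)$ and $L$ as above. Call a collection of fragments $(A,Y_j,K_j,\phi_j)$, $1\le j\le k$, with $Y_j=\{y_{j,1}<y_{j,2}<\cdots\}$, *good* if: $A\subseteq\bigcup_jY_j$; the $Y_j$ are disjoint; every reduced word is in $\bigcup_j Y_j$ or greater than all of its elements; with $c=\max(\{|y_{i,K_i-1}|:K_i>1\}\cup\{0\})$, every $y\in Y_j$ with $|y|\le c$ satisfies $K_j>1$ and $|y|\le|y_{j,K_j-1}|$; $\operatorname{dom}\phi_j=(A\times\{y_{j,1},\dots,y_{j,K_j-1}\})\cup(\{y_{j,1},\dots,y_{j,K_j-1}\}\times A)$; and $\operatorname{im}\phi_j\subseteq\bigcup_iY_i$. A snapshot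 $(A,Y,K,\varnothing,\phi)$ is the *union* of tuples $(A,Y_j,K_j,\phi_j)$, $1\le j\le k$, with $1\le K_j\le|Y_j|+1$, if $Y$ is the disjoint union of the $Y_j$, the set $\{y_1,\dots,y_{K-1}\}$ is the union of the sets $\{y_{j,1},\dots,y_{j,K_j-1}\}$, $\phi=\bigcup_j\phi_j$, and, with $L$ as in the definition of a snapshot, $\operatorname{dom}\phi_j=(A\times(Y_j\cap\{y_1,\dots,y_L\}))\cup(\{y_{j,1},\dots,y_{j,K_j-1}\}\times A)$ for all $j$. **Algorithm ConcurrentFroidurePin.** The input is $M\in\mathbb N$ and $k$ such tuples in a memory shared by $k$ processes; $b:S\to\{1,\dots,k\}$ is any fixed function, and we write $b(w)=b(\nu(w))$. Put $c:=\max(\{|y_{i,K_i-1}|:K_i>1\}\cup\{1\})$. While $K_j\le|Y_j|$ for some $j$ and $|Y_1\cup\dots\cup Y_k|<M$, empty all queues $Q_j$, perform the following three phases, and then increase $c$ by $1$. In each phase the processes $j=1,\dots,k$ run concurrently, without locks, their single read and write operations being interleaved arbitrarily; the next phase starts when all have finished. 1. *ApplyGenerators.* While $K_j\le|Y_j|$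 and $y:=y_{j,K_j}$ has length $c$: for each $a\in A$ in order, first try to deduce $\phi_j(y,a)$: if $s(y)\ne\varepsilon$, $s(y)\in Y_i$ and $z:=\phi_i(s(y),a)<s(y)a$, let $w:=\phi_m(f(y),p(z))\in Y_n$ where $p(z)\in Y_m$ (if $p(z)=\varepsilon$, $w:=f(y)$), and if $|w|<c$, or $n=j$ and $\phi_j(w,l(z))$ is already defined, put $\phi_j(y,a):=\phi_n(w,l(z))$. If nothing was deduced, put $\phi_j(y,a):=x$ if $\nu(ya)=\nu(x)$ for some $x\in Y_1\cup\dots\cup Y_k$, and otherwise add $(b(ya),ya)$ to $Q_j$. After the loop over $A$, increase $K_j$ by $1$. 2. *ProcessQueues.* For all queued words $wa$ in short-lex order, where $wa$ is in the queue $Q_n$: if $b(wa)=j$, put $\phi_n(w,a):=y$ if $\nu(wa)=\nu(y)$ for some $y\in Y_j$, and otherwise add $wa$ to $Y_j$ and put $\phi_n(w,a):=wa$. 3. For all $y\in\{y_{j,1},\dots,y_{j,K_j-1}\}$ with $|y|\ge c$ in increasing order and all $a\in A$ put $\phi_j(a,y):=\phi_n(\phi_m(a,p(y)),l(y))$, where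 $p(y)\in Y_m$ and $\phi_m(a,p(y))\in Y_n$ (if $p(y)=\varepsilon$, replace $\phi_m(a,p(y))$ by $a$). **Lemma (validity of ConcurrentFroidurePin).** Let $(A,Y,K,\varnothing,\phi)$ be a snapshot of $S$ and $M\in\mathbb N$. For every assignment of the words of $Y$ to $\{1,\dots,k\}$ there are $k$ tuples with union $(A,Y,K,\varnothing,\phi)$ whose sets $Y_j$ are given by this assignment. Let ConcurrentFroidurePin be run on any $k$ tuples with union $(A,Y,K,\varnothing,\phi)$. Then under every interleaving: * the algorithm terminates, no process gets stuck, and no undefined value of any $\phi_i$ is required; * in each phase, no memory location (the set $Y_i$, the index $K_i$, the queue $Q_i$, or the cell of a single value $\phi_i(u,v)$) that is written by one process is read or written by another process; * the tuples returned have as union a snapshot of $S$ with fourth component $\varnothing$ which extends $(A,Y,K,\varnothing,\phi)$ and has at least $\min\{M,|S|\}$ elements (where $|S|$ may be infinite), and each tuple returned extends the corresponding input tuple; * if the input is a good collection of fragments, or if the output differs from the input, then the output is a good collection of fragments. -/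

import Mathlib

namespace CFP

/-! ### Words, reduced words -/

/-- Words over the ordered alphabet `a_1 < ... < a_r`; the letter `a_i` is the index `i : Fin r`. -/
abbrev Word (r : ℕ) : Type := List (Fin r)

/-- The (strict) short-lex order. -/
def slt {r : ℕ} (u v : Word r) : Prop := List.Shortlex (fun a b : Fin r => a < b) u v

/-- A word consisting of a single letter. -/
def IsLetter {r : ℕ} (u : Word r) : Prop := ∃ a : Fin r, u = [a]

/-- The homomorphism `ν`.  Non-empty words take values in `U`; the empty word is sent to an external
identity adjoined to `U`, which is the value of no other word. -/
def val {U : Type*} [Semigroup U] {r : ℕ} (gen : Fin r → U) (w : Word r) : WithOne U :=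
  (w.map fun a => (gen a : WithOne U)).prod

/-- `w` is the short-lex least non-empty word with its value. -/
def Reduced {U : Type*} [Semigroup U] {r : ℕ} (gen : Fin r → U) (w : Word r) : Prop :=
  w ≠ [] ∧ ∀ v : Word r, v ≠ [] → val gen v = val gen w → v = w ∨ slt w v

/-- The number of elements of the semigroup `S = ⟨A⟩`, possibly infinite. -/
noncomputable def cardS {U : Type*} [Semigroup U] {r : ℕ} (gen : Fin r → U) : ℕ∞ :=
  (Subsemigroup.closure (Set.range gen) : Set U).encard

/-! ### Snapshots, fragments -/

/-- The data `(Y, K, B, φ)` of a snapshot.  `Y = [y_1, ..., y_N]` is kept as an increasing list, so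
that `{y_1, ..., y_i}` is `Y.take i`; `φ` is a partial function. -/
structure Snapshot (r : ℕ) where
  Y : List (Word r)
  K : ℕ
  B : Finset (Fin r)
  phi : Word r → Word r → Option (Word r)

/-- The data `(Y, K, φ)` of a fragment. -/
structure Fragment (r : ℕ) where
  Y : List (Word r)
  K : ℕ
  phi : Word r → Word r → Option (Word r)

/-- The word `y_{K-1}`, if `K > 1`. -/
def lastDone {r : ℕ} (Y : List (Word r)) (K : ℕ) : Option (Word r) := (Y.take (K - 1)).getLast?

/-- Either `L = K - 1`, or `L < K - 1` is the number of `y ∈ Y` with `|y| < |y_{K-1}|`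
(for increasing `Y` this is the largest `L` with `|y_L| < |y_{K-1}|`, and `0` if there is none). -/
def IsLeftBound {r : ℕ} (Y : List (Word r)) (K L : ℕ) : Prop :=
  L = K - 1 ∨
    (L < K - 1 ∧ ∃ z, lastDone Y K = some z ∧ L = Y.countP fun y => decide (y.length < z.length))

/-- `(A, Y, K, B, φ)` is a snapshot of `S = ⟨A⟩`. -/
structure IsSnapshot {U : Type*} [Semigroup U] {r : ℕ} (gen : Fin r → U) (T : Snapshot r) :
    Prop where
  sorted : T.Y.Pairwise slt
  letters : ∀ a : Fin r, [a] ∈ T.Y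
  reduced : ∀ y ∈ T.Y, Reduced gen y
  initial : ∀ x : Word r, Reduced gen x → x ∈ T.Y ∨ ∀ y ∈ T.Y, slt y x
  one_le : 1 ≤ T.K
  le : T.K ≤ T.Y.length + 1
  B_initial : ∀ a ∈ T.B, ∀ a' : Fin r, a' < a → a' ∈ T.B
  phi_val : ∀ u v x : Word r, T.phi u v = some x → x ∈ T.Y ∧ val gen x = val gen (u ++ v)
  phi_dom : ∃ L : ℕ, IsLeftBound T.Y T.K L ∧ ∀ u v : Word r, (T.phi u v).isSome ↔
    (IsLetter u ∧ v ∈ T.Y.take L) ∨ (u ∈ T.Y.take (T.K - 1) ∧ IsLetter v) ∨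
      (T.Y[T.K - 1]? = some u ∧ ∃ a ∈ T.B, v = [a])

/-- `T'` extends `T`. -/
def Snapshot.ExtendsTo {r : ℕ} (T T' : Snapshot r) : Prop :=
  T.K ≤ T'.K ∧ (∀ y ∈ T.Y, y ∈ T'.Y) ∧
    ∀ u v x : Word r, T.phi u v = some x → T'.phi u v = some x

/-- `F'` extends `F`. -/
def Fragment.ExtendsTo {r : ℕ} (F F' : Fragment r) : Prop :=
  F.K ≤ F'.K ∧ (∀ y ∈ F.Y, y ∈ F'.Y) ∧
    ∀ u v x : Word r, F.phi u v = some x → F'.phi u v = some x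

/-- `(A, Y, K, φ)` is a fragment for `S = ⟨A⟩`. -/
structure IsFragment {U : Type*} [Semigroup U] {r : ℕ} (gen : Fin r → U) (F : Fragment r) :
    Prop where
  sorted : F.Y.Pairwise slt
  reduced : ∀ y ∈ F.Y, Reduced gen y
  one_le : 1 ≤ F.K
  le : F.K ≤ F.Y.length + 1
  last : ∀ z, lastDone F.Y F.K = some z → ∀ y ∈ F.Y, y.length = z.length → y = z ∨ slt y z
  phi_val : ∀ u v x : Word r, F.phi u v = some x → Reduced gen x ∧ val gen x = val gen (u ++ v)
  phi_dom : ∃ L : ℕ, IsLeftBound F.Y F.K L ∧ ∀ u v : Word r, (F.phi u v).isSome ↔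
    (IsLetter u ∧ v ∈ F.Y.take L) ∨ (u ∈ F.Y.take (F.K - 1) ∧ IsLetter v)

/-- `max {|y_{i, K_i - 1}| : K_i > 1}`, and `0` if all `K_i = 1`. -/
def level {r k : ℕ} (F : Fin k → Fragment r) : ℕ :=
  Finset.univ.sup fun i => ((lastDone (F i).Y (F i).K).map List.length).getD 0

/-- A collection of fragments for `S` that is ready to be assembled into a snapshot: it contains the
generators, its sets `Y_j` are disjoint, their union is an initial segment of the reduced words,
in every fragment all words of length at most `c = level F` precede `y_{j,K_j}`, the domains are
full, and the values of the `φ_j` lie in the union.  The minimal collections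
(`K_j = 1`, `φ_j = ∅`, the `Y_j` a partition of `A`) are included, with `c = 0`. -/
structure GoodCollection {U : Type*} [Semigroup U] {r k : ℕ} (gen : Fin r → U)
    (F : Fin k → Fragment r) : Prop where
  fragment : ∀ j, IsFragment gen (F j)
  letters : ∀ a : Fin r, ∃ j, [a] ∈ (F j).Y
  disjoint : ∀ i j, i ≠ j → ∀ y ∈ (F i).Y, y ∉ (F j).Y
  initial : ∀ x : Word r, Reduced gen x → (∃ j, x ∈ (F j).Y) ∨ ∀ j, ∀ y ∈ (F j).Y, slt y x
  level : ∀ j, ∀ y ∈ (F j).Y, y.length ≤ level F →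
    ∃ z, lastDone (F j).Y (F j).K = some z ∧ y.length ≤ z.length
  dom : ∀ j, ∀ u v : Word r, ((F j).phi u v).isSome ↔
    (IsLetter u ∧ v ∈ (F j).Y.take ((F j).K - 1)) ∨ (u ∈ (F j).Y.take ((F j).K - 1) ∧ IsLetter v)
  im : ∀ j, ∀ u v x : Word r, (F j).phi u v = some x → ∃ i, x ∈ (F i).Y

/-- The snapshot data `T` is the union of the tuples `F_1, ..., F_k`: `Y` is the disjoint union of
the `Y_j`, the set `{y_1, ..., y_{K-1}}` is the union of the sets `{y_{j,1}, ..., y_{j,K_j-1}}`, `φ`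
is the union of the `φ_j`, and the products stored in `φ_j` are the left multiples in `φ` of the
words of `Y_j` and the right multiples in `φ` of the words of `Y_j`. -/
structure IsUnion {r k : ℕ} (F : Fin k → Fragment r) (T : Snapshot r) : Prop where
  sorted : ∀ j, (F j).Y.Pairwise slt
  disjoint : ∀ i j, i ≠ j → ∀ y ∈ (F i).Y, y ∉ (F j).Y
  mem : ∀ w : Word r, w ∈ T.Y ↔ ∃ j, w ∈ (F j).Y
  one_le : ∀ j, 1 ≤ (F j).K
  le : ∀ j, (F j).K ≤ (F j).Y.length + 1
  done : ∀ j, ∀ w ∈ (F j).Y, w ∈ (F j).Y.take ((F j).K - 1) ↔ w ∈ T.Y.take (T.K - 1)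
  phi : ∀ u v x : Word r, T.phi u v = some x ↔ ∃ j, (F j).phi u v = some x
  dom : ∃ L : ℕ, IsLeftBound T.Y T.K L ∧ ∀ j, ∀ u v : Word r, ((F j).phi u v).isSome ↔
    (IsLetter u ∧ v ∈ (F j).Y ∧ v ∈ T.Y.take L) ∨ (u ∈ (F j).Y.take ((F j).K - 1) ∧ IsLetter v)

/-! ### Shared memory and processes -/

/-- The locations of the shared memory of `k` processes: `Y_i`, `K_i`, the queue `Q_i`, and one
cell for each value `φ_i(u, v)`. -/
inductive Loc (r k : ℕ) : Type where
  | Y (i : Fin k) : Loc r k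
  | K (i : Fin k) : Loc r k
  | Q (i : Fin k) : Loc r k
  | phi (i : Fin k) (u v : Word r) : Loc r k
  deriving DecidableEq

/-- The contents of a location.  The element `(b(wa), wa)` of a queue is stored as `(b(wa), w, a)`,
and an undefined `φ_i(u, v)` as `none`. -/
@[reducible] def Loc.Val {r k : ℕ} : Loc r k → Type
  | .Y _ => List (Word r)
  | .K _ => ℕ
  | .Q _ => List (Fin k × Word r × Fin r)
  | .phi _ _ _ => Option (Word r)

/-- A state of the shared memory. -/
abbrev Mem (r k : ℕ) : Type := (l : Loc r k) → l.Val

/-- Sequential programs whose atomic steps read or write one location of the shared memory.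
`fail` is a crash: a crashed process never finishes. -/
inductive Prog (r k : ℕ) (α : Type) : Type where
  | ret (x : α) : Prog r k α
  | fail : Prog r k α
  | read (l : Loc r k) (next : l.Val → Prog r k α) : Prog r k α
  | write (l : Loc r k) (v : l.Val) (next : Prog r k α) : Prog r k α

def Prog.bind {r k : ℕ} {α β : Type} : Prog r k α → (α → Prog r k β) → Prog r k β
  | .ret x, f => f x
  | .fail, _ => .fail
  | .read l next, f => .read l fun v => (next v).bind f
  | .write l v next, f => .write l v (next.bind f)

instance {r k : ℕ} : Monad (Prog r k) where
  pure := Prog.ret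
  bind := Prog.bind

def getY {r k : ℕ} (i : Fin k) : Prog r k (List (Word r)) := .read (.Y i) .ret
def getK {r k : ℕ} (i : Fin k) : Prog r k ℕ := .read (.K i) .ret
def getQ {r k : ℕ} (i : Fin k) : Prog r k (List (Fin k × Word r × Fin r)) := .read (.Q i) .ret
def getPhi {r k : ℕ} (i : Fin k) (u v : Word r) : Prog r k (Option (Word r)) :=
  .read (.phi i u v) .ret
def put {r k : ℕ} (l : Loc r k) (v : l.Val) : Prog r k Unit := .write l v (.ret ())

/-- A value that has to exist. -/
def require {r k : ℕ} {α : Type} : Option α → Prog r k α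
  | some x => .ret x
  | none => .fail

/-- Read `φ_i(u, v)`; reading an undefined value is a crash. -/
def getDefined {r k : ℕ} (i : Fin k) (u v : Word r) : Prog r k (Word r) := do
  let x ← getPhi i u v
  require x

/-- Run `f` for the members of a list in turn. -/
def forEach {r k : ℕ} {ι : Type} (f : ι → Prog r k Unit) : List ι → Prog r k Unit
  | [] => .ret ()
  | x :: xs => do
    f x
    forEach f xs

/-- Read something from each of the given fragments in turn. -/
def readAll {r k : ℕ} {α : Type} (f : Fin k → Prog r k α) : List (Fin k) → Prog r k (List (Fin k × α))
  | [] => .ret []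
  | i :: is => do
    let x ← f i
    let xs ← readAll f is
    return (i, x) :: xs

/-- The index `i` with `w ∈ Y_i`. -/
def owner {r k : ℕ} (w : Word r) : Prog r k (Fin k) := do
  let Ys ← readAll getY (List.finRange k)
  require ((Ys.find? fun p => decide (w ∈ p.2)).map Prod.fst)

/-- The value `φ_m(a, u)` where `u ∈ Y_m`, with `φ(a, ε) = a` for the empty word `ε`. -/
def leftMultiple {r k : ℕ} (a : Fin r) (u : Word r) : Prog r k (Word r) :=
  if u = [] then return [a] else do
    let m ← owner u
    getDefined m [a] u

/-! ### The three phases of the concurrent Froidure–Pin algorithm -/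

open Classical in
/-- Process `j` tries to deduce the right multiple of `y` (a word of length `c` in `Y_j`) by `a`
from known products; `none` means that this is not possible.  If the first letter `f` of `y` is
followed by the empty word, then there is nothing to deduce from.  A value `φ_j(w, l)` of the
process's own fragment with `|w| = c` might not have been determined so far, in which case nothing
is deduced. -/
noncomputable def deduce {r k : ℕ} (c : ℕ) (j : Fin k) (y : Word r) (a : Fin r) :
    Prog r k (Option (Word r)) :=
  match y with
  | [] => .fail
  | f :: s =>
    if s = [] then return none else do
      let i ← owner s
      let v ← getDefined i s [a]
      if slt v (s ++ [a]) then
        let l ← require v.getLast?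
        let w ← leftMultiple f v.dropLast
        let n ← owner w
        if w.length < c then
          let x ← getDefined n w [l]
          return some x
        else if n = j then
          getPhi j w [l]
        else
          return none
      else
        return none

open Classical in
/-- The body of the loop over the generators in `ApplyGenerators`. -/
noncomputable def applyGenerator {U : Type*} [Semigroup U] {r k : ℕ} (gen : Fin r → U)
    (b : WithOne U → Fin k) (c : ℕ) (j : Fin k) (y : Word r) (a : Fin r) : Prog r k Unit := do
  let z ← deduce c j y a
  match z with
  | some x => put (.phi j y [a]) (some x)
  | none =>
    let Ys ← readAll getY (List.finRange k)
    match (Ys.flatMap Prod.snd).find? fun x => decide (val gen x = val gen (y ++ [a])) with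
    | some x => put (.phi j y [a]) (some x)
    | none =>
      let q ← getQ j
      put (.Q j) (q ++ [(b (val gen (y ++ [a])), y, a)])

/-- `ApplyGenerators` for the `j`-th fragment.  Since `Y_j` does not change, the words met by the
loop `while K_j ≤ |Y_j| and |y_{j,K_j}| = c` are those in the list `ys`. -/
noncomputable def applyGenerators {U : Type*} [Semigroup U] {r k : ℕ} (gen : Fin r → U)
    (b : WithOne U → Fin k) (c : ℕ) (j : Fin k) : Prog r k Unit := do
  let Y ← getY j
  let K ← getK j
  let ys := (Y.drop (K - 1)).takeWhile fun y => decide (y.length = c)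
  forEach (fun y => do
    forEach (applyGenerator gen b c j y) (List.finRange r)
    let K' ← getK j
    put (.K j) (K' + 1)) ys

open Classical in
/-- All queued words, each with the index of its queue, in short-lex order. -/
noncomputable def sortQueues {r k : ℕ} (Qs : List (Fin k × List (Fin k × Word r × Fin r))) :
    List (Fin k × Fin k × Word r × Fin r) :=
  (Qs.flatMap fun p => p.2.map fun e => (p.1, e)).mergeSort fun e e' =>
    decide (¬ slt (e'.2.2.1 ++ [e'.2.2.2]) (e.2.2.1 ++ [e.2.2.2]))

open Classical in
/-- `ProcessQueues` for the `j`-th fragment: the loop over the queued words `wa ∈ Q_n` with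
`b(wa) = j`.  As `w ∈ Y_n` for `wa ∈ Q_n`, it is the function `φ_n` that is defined at `(w, a)`. -/
noncomputable def processQueues {U : Type*} [Semigroup U] {r k : ℕ} (gen : Fin r → U)
    (j : Fin k) : Prog r k Unit := do
  let Qs ← readAll getQ (List.finRange k)
  forEach (fun (e : Fin k × Fin k × Word r × Fin r) =>
    match e with
    | (n, i, w, a) =>
      if i = j then do
        let Y ← getY j
        match Y.find? fun y => decide (val gen y = val gen (w ++ [a])) with
        | some y => put (.phi n w [a]) (some y)
        | none => do
          put (.Y j) (Y ++ [w ++ [a]])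
          put (.phi n w [a]) (some (w ++ [a]))
      else return ()) (sortQueues Qs)

/-- The third phase for the `j`-th fragment: the left multiples of the words of length `c` in
`Y_j`. -/
def extendLeft {r k : ℕ} (c : ℕ) (j : Fin k) : Prog r k Unit := do
  let Y ← getY j
  let K ← getK j
  let L := Y.countP fun y => decide (y.length < c)
  forEach (fun y => do
    forEach (fun a => do
      let l ← require y.getLast?
      let w ← leftMultiple a y.dropLast
      let n ← owner w
      let x ← getDefined n w [l]
      put (.phi j [a] y) (some x)) (List.finRange r)) ((Y.take (K - 1)).drop L)

/-! ### Concurrent executions of the algorithm -/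

/-- `head` is the test of the main loop, `apply`, `process`, `extend` are the three concurrent
phases of an iteration, `done` is termination. -/
inductive Phase : Type where
  | head | apply | process | extend | done

/-- A configuration: the shared memory, the counter `c`, the current phase, what remains to be run
by each process in the current phase, and the accesses to the shared memory made by the processes
in the current phase (`true` for a write). -/
structure Config (r k : ℕ) where
  mem : Mem r k
  c : ℕ
  phase : Phase
  procs : Fin k → Prog r k Unit
  log : List (Fin k × Loc r k × Bool)

/-- The tuples `(Y_j, K_j, φ_j)` in the shared memory. -/
def fragments {r k : ℕ} (m : Mem r k) (j : Fin k) : Fragment r where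
  Y := m (.Y j)
  K := m (.K j)
  phi u v := m (.phi j u v)

/-- `∃ j, K_j ≤ |Y_j|` and `|Y_1 ∪ ... ∪ Y_k| < M`. -/
def LoopCondition {r k : ℕ} (M : ℕ) (m : Mem r k) : Prop :=
  (∃ j, (fragments m j).K ≤ (fragments m j).Y.length) ∧
    (Finset.univ.biUnion fun j => (fragments m j).Y.toFinset).card < M

/-- Reset all queues. -/
def clearQueues {r k : ℕ} (m : Mem r k) : Mem r k
  | .Q _ => []
  | .Y i => m (.Y i)
  | .K i => m (.K i)
  | .phi i u v => m (.phi i u v)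

/-- The single steps of the algorithm.  Within a phase the atomic steps of the `k` processes are
interleaved arbitrarily; a phase ends when all processes have finished. -/
inductive Step {U : Type*} [Semigroup U] {r k : ℕ} (gen : Fin r → U) (b : WithOne U → Fin k)
    (M : ℕ) : Config r k → Config r k → Prop where
  | enter (C : Config r k) (hp : C.phase = .head) (hc : LoopCondition M C.mem) :
      Step gen b M C
        ⟨clearQueues C.mem, C.c, .apply, fun j => applyGenerators gen b C.c j, []⟩
  | exit (C : Config r k) (hp : C.phase = .head) (hc : ¬ LoopCondition M C.mem) :
      Step gen b M C ⟨C.mem, C.c, .done, C.procs, []⟩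
  | read (C : Config r k) (j : Fin k) (l : Loc r k) (next : l.Val → Prog r k Unit)
      (hj : C.procs j = .read l next) :
      Step gen b M C ⟨C.mem, C.c, C.phase, Function.update C.procs j (next (C.mem l)),
        (j, l, false) :: C.log⟩
  | write (C : Config r k) (j : Fin k) (l : Loc r k) (v : l.Val) (next : Prog r k Unit)
      (hj : C.procs j = .write l v next) :
      Step gen b M C ⟨Function.update C.mem l v, C.c, C.phase, Function.update C.procs j next,
        (j, l, true) :: C.log⟩
  | endApply (C : Config r k) (hp : C.phase = .apply) (hr : ∀ j, C.procs j = .ret ()) :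
      Step gen b M C ⟨C.mem, C.c, .process, fun j => processQueues gen j, []⟩
  | endProcess (C : Config r k) (hp : C.phase = .process) (hr : ∀ j, C.procs j = .ret ()) :
      Step gen b M C ⟨C.mem, C.c, .extend, fun j => extendLeft C.c j, []⟩
  | endExtend (C : Config r k) (hp : C.phase = .extend) (hr : ∀ j, C.procs j = .ret ()) :
      Step gen b M C ⟨C.mem, C.c + 1, .head, C.procs, []⟩

/-- The memory holding the input tuples. -/
def initialMem {r k : ℕ} (F : Fin k → Fragment r) : Mem r k
  | .Q _ => []
  | .Y i => (F i).Y
  | .K i => (F i).K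
  | .phi i u v => (F i).phi u v

/-- The start of the algorithm: `c = max ({|y_{i, K_i - 1}| : K_i > 1} ∪ {1})`. -/
def start {r k : ℕ} (F : Fin k → Fragment r) : Config r k :=
  ⟨initialMem F, max (level F) 1, .head, fun _ => .ret (), []⟩

/-- No location is accessed by two different processes of a phase, one of which writes to it. -/
def NoConflict {r k : ℕ} (log : List (Fin k × Loc r k × Bool)) : Prop :=
  ∀ e ∈ log, ∀ e' ∈ log, e.1 ≠ e'.1 → e.2.1 = e'.2.1 → e.2.2 = false ∧ e'.2.2 = false

end CFP

namespace CFP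

/-! ### Short-lex order and reduced words -/

section Words

variable {U : Type*} [Semigroup U] {r : ℕ} {gen : Fin r → U} {u v w x y : Word r}

/-! Short-lex order is compatible with multiplication on both sides. Hence non-empty prefixes and
suffixes of reduced words are reduced, and every value of a non-empty word belongs to exactly one
reduced word. A stored product is therefore determined by its value, however it was computed.

Concurrency is eliminated by ownership. In each phase every location has one owner or none, and `wp`
says that a process, run alone, writes only what it owns, reads only what it owns or what nobody
owns, does not crash and reaches its goal. Writes of the other processes change nothing that it can
see (`wp_congr`), so this sequential statement survives every interleaving (`Running.write`), and
two processes cannot conflict (`Running.noConflict`). The owners reflect the algorithm. In the first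
phase the cells `φ_i(u, v)` with `|u| ≥ c` belong to `i`; in the second, `Y_j` and all cells whose
product is assigned to `j` by `b` belong to `j`; in the third, the cells `φ_j(a, y)` with `y ∈ Y_j`
and `|y| ≥ c` belong to `j`.

The sequential part is an invariant with three length thresholds `p`, `q`, `l`, which pass from `(c,
c+1, c)` to `(c+1, c+1, c)` and then to `(c+1, c+1, c+1)` in an iteration. A deduction in the first
phase rewrites `f s a` as `f p(z) l(z)` with `z = φ(s, a)` (`wp_deduce`). In the second phase the
reduced form of a new queued word is itself queued, is assigned to the same process and comes no
later; so a word whose value is not found is reduced (`wp_processQueues`). In the third phase `φ(a,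
p(y))` has length at most `c`, so its right multiples are known (`wp_extendLeft_step`).

An unfinished word has at least `c` non-empty prefixes, all of them reduced and known, so the loop
runs only while `c < M` (`Inv.lt_of_loopCondition`). After an iteration the done words are precisely
those shorter than the new `c`, which yields both a snapshot and a good collection. -/

theorem slt_iff : slt u v ↔ u.length < v.length ∨ u.length = v.length ∧ u < v := by
  rw [slt, List.shortlex_def, ← List.lt_iff_lex_lt]
  exact Iff.rfl

theorem slt_irrefl (u : Word r) : ¬ slt u u := by simp [slt_iff]

theorem slt_trans (h : slt u v) (h' : slt v w) : slt u w := by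
  rw [slt_iff] at *
  rcases h with h | ⟨h, h1⟩ <;> rcases h' with h' | ⟨h', h1'⟩
  · exact .inl (h.trans h')
  · exact .inl (h' ▸ h)
  · exact .inl (h ▸ h')
  · exact .inr ⟨h.trans h', h1.trans h1'⟩

theorem slt_asymm (h : slt u v) : ¬ slt v u := fun h' => slt_irrefl _ (slt_trans h h')

theorem slt_trichotomy (u v : Word r) : slt u v ∨ u = v ∨ slt v u := by
  simp only [slt_iff]
  rcases lt_trichotomy u.length v.length with h | h | h
  · exact .inl (.inl h)
  · rcases lt_trichotomy u v with h' | h' | h'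
    · exact .inl (.inr ⟨h, h'⟩)
    · exact .inr (.inl h')
    · exact .inr (.inr (.inr ⟨h.symm, h'⟩))
  · exact .inr (.inr (.inl h))

theorem slt_wf : WellFounded (slt (r := r)) := List.Shortlex.wf wellFounded_lt

theorem slt_of_length_lt (h : u.length < v.length) : slt u v := slt_iff.2 (.inl h)

theorem length_le_of_slt (h : slt u v) : u.length ≤ v.length := by
  rcases slt_iff.1 h with h | h
  · exact h.le
  · exact h.1.le

/-- For equally long `u` and `v` the lexicographic comparison is decided inside them, so any
suffixes of equal length may follow. -/
theorem slt_append (h : slt u v) (hw : w.length = x.length) : slt (u ++ w) (v ++ x) := by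
  rcases List.shortlex_def.1 h with h | ⟨h, h'⟩
  · exact slt_of_length_lt (by simpa [hw] using h)
  · refine List.Shortlex.of_lex (by simp [h, hw]) ?_
    induction h' with
    | nil => simp at h
    | cons h' ih =>
      have h1 := Nat.succ.inj h
      exact .cons (ih (List.shortlex_def.2 (.inr ⟨h1, h'⟩)) h1)
    | rel h' => exact .rel h'

theorem val_append (gen : Fin r → U) (u v : Word r) :
    val gen (u ++ v) = val gen u * val gen v := by
  simp [val]

theorem exists_val_eq_of_mem_closure {s : U} (hs : s ∈ Subsemigroup.closure (Set.range gen)) :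
    ∃ w : Word r, w ≠ [] ∧ val gen w = (s : WithOne U) := by
  induction hs using Subsemigroup.closure_induction with
  | mem s h =>
    obtain ⟨a, rfl⟩ := h
    exact ⟨[a], by simp, by simp [val]⟩
  | mul s t _ _ hs ht =>
    obtain ⟨u, hu, hu'⟩ := hs
    obtain ⟨v, hv, hv'⟩ := ht
    exact ⟨u ++ v, by simp [hu], by rw [val_append, hu', hv', WithOne.coe_mul]⟩

theorem Reduced.eq_of_val_eq (hx : Reduced gen x) (hy : Reduced gen y)
    (h : val gen x = val gen y) : x = y := by
  rcases hx.2 y hy.1 h.symm with h1 | h1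
  · exact h1.symm
  · rcases hy.2 x hx.1 h with h2 | h2
    · exact h2
    · exact absurd h1 (slt_asymm h2)

theorem exists_reduced (gen : Fin r → U) (hw : w ≠ []) :
    ∃ x, Reduced gen x ∧ val gen x = val gen w := by
  obtain ⟨x, ⟨hx, hx'⟩, hmin⟩ := slt_wf.has_min {x : Word r | x ≠ [] ∧ val gen x = val gen w}
    ⟨w, hw, rfl⟩
  refine ⟨x, ⟨hx, fun v hv h => ?_⟩, hx'⟩
  rcases slt_trichotomy v x with h1 | h1 | h1
  · exact absurd h1 (hmin v ⟨hv, h.trans hx'⟩)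
  · exact .inl h1
  · exact .inr h1

theorem Reduced.length_le (hx : Reduced gen x) (hv : v ≠ []) (h : val gen v = val gen x) :
    x.length ≤ v.length := by
  rcases hx.2 v hv h with rfl | h1
  · exact le_rfl
  · exact length_le_of_slt h1

/-- A smaller word with the value of the prefix would, by `slt_append`, give a smaller word with the
value of the whole. -/
theorem Reduced.of_append (h : Reduced gen (u ++ w)) (hu : u ≠ []) : Reduced gen u := by
  refine ⟨hu, fun v hv hval => ?_⟩
  rcases slt_trichotomy v u with h1 | h1 | h1
  · have h2 : val gen (v ++ w) = val gen (u ++ w) := by rw [val_append, hval, val_append]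
    have h3 := slt_append h1 (rfl : w.length = w.length)
    rcases h.2 (v ++ w) (by simp [hv]) h2 with h4 | h4
    · rw [h4] at h3
      exact absurd h3 (slt_irrefl _)
    · exact absurd h3 (slt_asymm h4)
  · exact .inl h1
  · exact .inr h1

theorem Reduced.of_append_right (h : Reduced gen (w ++ u)) (hu : u ≠ []) : Reduced gen u := by
  refine ⟨hu, fun v hv hval => ?_⟩
  rcases slt_trichotomy v u with h1 | h1 | h1
  · have h2 : val gen (w ++ v) = val gen (w ++ u) := by rw [val_append, hval, val_append]
    have h3 : slt (w ++ v) (w ++ u) := List.Shortlex.append_left h1 w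
    rcases h.2 (w ++ v) (by simp [hv]) h2 with h4 | h4
    · rw [h4] at h3
      exact absurd h3 (slt_irrefl _)
    · exact absurd h3 (slt_asymm h4)
  · exact .inl h1
  · exact .inr h1

theorem Reduced.dropLast (h : Reduced gen x) (h' : x.dropLast ≠ []) :
    Reduced gen x.dropLast := by
  rw [← List.dropLast_append_getLast h.1] at h
  exact h.of_append h'

theorem getLast?_eq_some (h : x ≠ []) : ∃ l, x.getLast? = some l ∧ x.dropLast ++ [l] = x :=
  ⟨x.getLast h, List.getLast?_eq_some_getLast h, List.dropLast_append_getLast h⟩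

end Words

/-! ### Sorted lists of words -/

section Sorted

variable {r : ℕ} {Y : List (Word r)}

theorem nodup_of_sorted (h : Y.Pairwise slt) : Y.Nodup :=
  List.Pairwise.imp (fun {a b} hab (heq : a = b) => slt_irrefl b (heq ▸ hab)) h

/-- An initial part of a sorted list is closed under passing to smaller members. -/
theorem mem_take_of_slt (h : Y.Pairwise slt) {n : ℕ} {y z : Word r} (hz : z ∈ Y.take n)
    (hy : y ∈ Y) (hyz : slt y z) : y ∈ Y.take n := by
  rw [← List.take_append_drop n Y, List.pairwise_append] at h
  rw [← List.take_append_drop n Y, List.mem_append] at hy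
  exact hy.resolve_right fun hy => slt_asymm hyz (h.2.2 z hz y hy)

/-- By hypothesis, whatever precedes a member satisfying `p` satisfies `p` as well, so these members
form an initial part of the list. -/
theorem take_countP {p : Word r → Bool} (h : Y.Pairwise fun y z => p z = true → p y = true) :
    Y.take (Y.countP p) = Y.filter p := by
  induction Y with
  | nil => rfl
  | cons y Y ih =>
    rw [List.pairwise_cons] at h
    by_cases hy : p y = true
    · simp [hy, ih h.2]
    · have h0 : ∀ z ∈ Y, ¬ p z = true := fun z hz hz' => hy (h.1 z hz hz')
      have h1 : Y.filter p = [] := List.filter_eq_nil_iff.2 h0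
      have h2 : Y.countP p = 0 := List.countP_eq_zero.2 h0
      simp [hy, h1, h2]

theorem take_countP_length_lt (h : Y.Pairwise slt) (n : ℕ) :
    Y.take (Y.countP fun y => decide (y.length < n)) =
      Y.filter fun y => decide (y.length < n) := by
  refine take_countP (h.imp fun hyz hz => ?_)
  have := length_le_of_slt hyz
  simp only [decide_eq_true_eq] at *
  omega

theorem mem_take_countP_length_lt (h : Y.Pairwise slt) {n : ℕ} {y : Word r} :
    y ∈ Y.take (Y.countP fun y => decide (y.length < n)) ↔ y ∈ Y ∧ y.length < n := by
  simp [take_countP_length_lt h n]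

theorem lastDone_mem {K : ℕ} {z : Word r} (h : lastDone Y K = some z) : z ∈ Y.take (K - 1) :=
  List.mem_of_getLast? h

theorem exists_lastDone (hY : Y.Pairwise slt) {K : ℕ} {y : Word r} (hy : y ∈ Y.take (K - 1)) :
    ∃ z, lastDone Y K = some z ∧ (y = z ∨ slt y z) := by
  have hs := hY.sublist (List.take_sublist (K - 1) Y)
  have hne : Y.take (K - 1) ≠ [] := List.ne_nil_of_mem hy
  refine ⟨_, List.getLast?_eq_some_getLast hne, ?_⟩
  rw [← List.dropLast_append_getLast hne] at hy hs
  rw [List.pairwise_append] at hs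
  rcases List.mem_append.1 hy with h | h
  · exact .inr (hs.2.2 y h _ (by simp))
  · exact .inl (by simpa using h)

theorem lastDone_spec (hY : Y.Pairwise slt) {K : ℕ} {y z : Word r} (h : lastDone Y K = some z)
    (hy : y ∈ Y.take (K - 1)) : y = z ∨ slt y z := by
  obtain ⟨z', hz', h'⟩ := exists_lastDone hY hy
  rw [h] at hz'
  cases hz'
  exact h'

end Sorted

/-! ### Sequential correctness of a process with respect to an assignment of owners -/

section Wp

variable {r k : ℕ} {α β : Type} {own : Loc r k → Option (Fin k)} {j : Fin k} {m : Mem r k}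

/-- Process `j` may read the location `l`. -/
def Readable (own : Loc r k → Option (Fin k)) (j : Fin k) (l : Loc r k) : Prop :=
  own l = none ∨ own l = some j

/-- Run alone from the memory `m`, the process `j` reads and writes only locations that it may
read and that it owns, respectively, does not crash, and finishes with a result and a memory that
satisfy `Q`. -/
def wp (own : Loc r k → Option (Fin k)) (j : Fin k) :
    Prog r k α → Mem r k → (α → Mem r k → Prop) → Prop
  | .ret x, m, Q => Q x m
  | .fail, _, _ => False
  | .read l next, m, Q => Readable own j l ∧ wp own j (next (m l)) m Q
  | .write l v next, m, Q => own l = some j ∧ wp own j next (Function.update m l v) Q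

theorem wp_mono {P : Prog r k α} {Q Q' : α → Mem r k → Prop} (h : wp own j P m Q)
    (hQ : ∀ x m', Q x m' → Q' x m') : wp own j P m Q' := by
  induction P generalizing m with
  | ret x => exact hQ _ _ h
  | fail => exact h
  | read l next ih => exact ⟨h.1, ih _ h.2⟩
  | write l v next ih => exact ⟨h.1, ih h.2⟩

theorem wp_bind {P : Prog r k α} {f : α → Prog r k β} {Q : β → Mem r k → Prop}
    (h : wp own j P m fun x m' => wp own j (f x) m' Q) : wp own j (P >>= f) m Q := by
  change wp own j (P.bind f) m Q
  induction P generalizing m with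
  | ret x => exact h
  | fail => exact h
  | read l next ih => exact ⟨h.1, ih _ h.2⟩
  | write l v next ih => exact ⟨h.1, ih h.2⟩

theorem wp_pure {x : α} {Q : α → Mem r k → Prop} (h : Q x m) :
    wp own j (pure x : Prog r k α) m Q := h

/-- The condition `Q` depends only on locations that process `j` may read. -/
def Stable (own : Loc r k → Option (Fin k)) (j : Fin k) (Q : Mem r k → Prop) : Prop :=
  ∀ m m' : Mem r k, (∀ l, Readable own j l → m l = m' l) → Q m → Q m'

/-- The crux of the reduction to sequential reasoning: control flow depends only on values read,
which agree in both memories, and every write makes the memories agree at the location written. -/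
theorem wp_congr {P : Prog r k α} {Q : α → Mem r k → Prop} {m' : Mem r k}
    (hQ : ∀ x, Stable own j (Q x)) (hm : ∀ l, Readable own j l → m l = m' l)
    (h : wp own j P m Q) : wp own j P m' Q := by
  induction P generalizing m m' with
  | ret x => exact hQ x m m' hm h
  | fail => exact h
  | read l next ih => exact ⟨h.1, by rw [← hm l h.1]; exact ih _ hm h.2⟩
  | write l v next ih =>
    refine ⟨h.1, ih (fun l' hl' => ?_) h.2⟩
    by_cases hl : l' = l
    · subst hl
      simp
    · simp [hl, hm l' hl']

theorem wp_getY {i : Fin k} {Q : List (Word r) → Mem r k → Prop} (hl : Readable own j (.Y i))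
    (h : Q (m (.Y i)) m) : wp own j (getY i) m Q := ⟨hl, h⟩

theorem wp_getK {i : Fin k} {Q : ℕ → Mem r k → Prop} (hl : Readable own j (.K i))
    (h : Q (m (.K i)) m) : wp own j (getK i) m Q := ⟨hl, h⟩

theorem wp_getQ {i : Fin k} {Q : List (Fin k × Word r × Fin r) → Mem r k → Prop}
    (hl : Readable own j (.Q i)) (h : Q (m (.Q i)) m) : wp own j (getQ i) m Q := ⟨hl, h⟩

theorem wp_getPhi {i : Fin k} {u v : Word r} {Q : Option (Word r) → Mem r k → Prop}
    (hl : Readable own j (.phi i u v)) (h : Q (m (.phi i u v)) m) :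
    wp own j (getPhi i u v) m Q := ⟨hl, h⟩

theorem wp_put {l : Loc r k} {v : l.Val} {Q : Unit → Mem r k → Prop} (hl : own l = some j)
    (h : Q () (Function.update m l v)) : wp own j (put l v) m Q := ⟨hl, h⟩

theorem wp_require {o : Option α} {x : α} {Q : α → Mem r k → Prop} (ho : o = some x)
    (h : Q x m) : wp own j (require o) m Q := by
  subst ho
  exact h

theorem wp_getDefined {i : Fin k} {u v x : Word r} {Q : Word r → Mem r k → Prop}
    (hl : Readable own j (.phi i u v)) (hx : m (.phi i u v) = some x) (h : Q x m) :
    wp own j (getDefined i u v) m Q :=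
  wp_bind (wp_getPhi hl (wp_require hx h))

theorem wp_readAll {f : Fin k → Prog r k α} {g : Fin k → α} {is : List (Fin k)}
    {Q : List (Fin k × α) → Mem r k → Prop}
    (hf : ∀ i Q', Q' (g i) m → wp own j (f i) m Q')
    (h : Q (is.map fun i => (i, g i)) m) : wp own j (readAll f is) m Q := by
  induction is generalizing Q with
  | nil => exact h
  | cons i is ih => exact wp_bind (hf i _ (wp_bind (ih h)))

/-- The postcondition is demanded for every index whose list contains `w`, so disjointness of the
lists is not needed here. -/
theorem wp_owner {w : Word r} {Q : Fin k → Mem r k → Prop}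
    (hY : ∀ i, Readable own j (.Y i)) (hw : ∃ i, w ∈ m (.Y i))
    (h : ∀ i, w ∈ m (.Y i) → Q i m) : wp own j (owner w) m Q := by
  refine wp_bind (wp_readAll (g := fun i => m (.Y i)) (fun i Q' hQ' => wp_getY (hY i) hQ') ?_)
  obtain ⟨i, hi⟩ := hw
  cases hf : ((List.finRange k).map fun i => (i, m (.Y i))).find?
      fun p : Fin k × List (Word r) => decide (w ∈ p.2) with
  | none =>
    rw [List.find?_eq_none] at hf
    simpa [hi] using hf (i, m (.Y i)) (by simp)
  | some p =>
    refine wp_require (x := p.1) rfl (h _ ?_)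
    obtain ⟨i', -, rfl⟩ := List.mem_map.1 (List.mem_of_find?_eq_some hf)
    simpa using List.find?_some hf

theorem wp_leftMultiple {a : Fin r} {u : Word r} {Q : Word r → Mem r k → Prop}
    (hY : ∀ i, Readable own j (.Y i)) (hnil : u = [] → Q [a] m)
    (hu : u ≠ [] → ∃ i, u ∈ m (.Y i))
    (h : u ≠ [] → ∀ i, u ∈ m (.Y i) → Readable own j (.phi i [a] u) ∧
      ∃ x, m (.phi i [a] u) = some x ∧ Q x m) :
    wp own j (leftMultiple a u) m Q := by
  unfold leftMultiple
  by_cases hu' : u = []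
  · rw [if_pos hu']
    exact wp_pure (hnil hu')
  · rw [if_neg hu']
    refine wp_bind (wp_owner hY (hu hu') fun i hi => ?_)
    obtain ⟨h1, x, h2, h3⟩ := h hu' i hi
    exact wp_getDefined h1 h2 h3

/-- The rule for loops: `I` relates the part of the list that has been dealt with to the memory. -/
theorem wp_forEach {ι : Type} {f : ι → Prog r k Unit} (I : List ι → Mem r k → Prop) {xs : List ι}
    (h0 : I [] m)
    (hstep : ∀ pre x post, xs = pre ++ x :: post → ∀ m, I pre m →
      wp own j (f x) m fun _ m' => I (pre ++ [x]) m') :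
    wp own j (forEach f xs) m fun _ m' => I xs m' := by
  -- Generalizing over the part already treated makes induction on the remaining part possible.
  suffices H : ∀ post pre m, xs = pre ++ post → I pre m →
      wp own j (forEach f post) m fun _ m' => I xs m' from H xs [] m rfl h0
  intro post
  induction post with
  | nil =>
    intro pre m hx hI
    rw [List.append_nil] at hx
    exact hx ▸ hI
  | cons x post ih =>
    intro pre m hx hI
    exact wp_bind (wp_mono (hstep pre x post hx m hI) fun _ m' hm' =>
      ih (pre ++ [x]) m' (by simp [hx]) hm')

end Wp

/-! ### The invariant of the algorithm -/

section Invariant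

variable {U : Type*} [Semigroup U] {r k : ℕ} {gen : Fin r → U} {m m' : Mem r k} {p q l : ℕ}

/-- The words `y_{j,1}, ..., y_{j,K_j-1}`. -/
def doneWords (m : Mem r k) (j : Fin k) : List (Word r) := (m (.Y j)).take (m (.K j) - 1)

/-- The memory holds disjoint increasing lists of reduced words whose union is an initial segment
of the reduced words and contains the letters; all words of length less than `p` and no words of
length at least `q` are done; all values stored are correct; the left multiples of the done words
of length less than `l` have been stored, and only multiples of done words have been stored. -/
structure Base (gen : Fin r → U) (m : Mem r k) (p q l : ℕ) : Prop where
  sorted : ∀ j, (m (.Y j)).Pairwise slt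
  disjoint : ∀ i j w, w ∈ m (.Y i) → w ∈ m (.Y j) → i = j
  reduced : ∀ j, ∀ y ∈ m (.Y j), Reduced gen y
  letters : ∀ a : Fin r, ∃ j, [a] ∈ m (.Y j)
  initial : ∀ x : Word r, Reduced gen x → (∃ j, x ∈ m (.Y j)) ∨ ∀ j, ∀ y ∈ m (.Y j), slt y x
  one_le : ∀ j, 1 ≤ m (.K j)
  le : ∀ j, m (.K j) ≤ (m (.Y j)).length + 1
  done_of_lt : ∀ j, ∀ w ∈ m (.Y j), w.length < p → w ∈ doneWords m j
  lt_of_done : ∀ j, ∀ w ∈ doneWords m j, w.length < q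
  phi_val : ∀ j u v x, m (.phi j u v) = some x →
    (∃ i, x ∈ m (.Y i)) ∧ val gen x = val gen (u ++ v)
  dom_left : ∀ j, ∀ v ∈ doneWords m j, v.length < l → ∀ a, ∃ x, m (.phi j [a] v) = some x
  dom_only : ∀ j u v x, m (.phi j u v) = some x →
    (IsLetter u ∧ v ∈ doneWords m j) ∨ (u ∈ doneWords m j ∧ IsLetter v)

/-- Moreover, the right multiples of all done words have been stored. -/
structure Inv (gen : Fin r → U) (m : Mem r k) (p q l : ℕ) : Prop extends Base gen m p q l where
  dom_right : ∀ j, ∀ u ∈ doneWords m j, ∀ a, ∃ x, m (.phi j u [a]) = some x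

theorem mem_of_mem_doneWords {j : Fin k} {w : Word r} (h : w ∈ doneWords m j) :
    w ∈ m (.Y j) := List.mem_of_mem_take h

theorem Base.mem_of_slt (I : Base gen m p q l) {x y : Word r} {i : Fin k} (hx : Reduced gen x)
    (hy : y ∈ m (.Y i)) (h : slt x y) : ∃ j, x ∈ m (.Y j) :=
  (I.initial x hx).resolve_right fun h' => slt_asymm h (h' i y hy)

theorem Base.eq_of_val_eq (I : Base gen m p q l) {x y : Word r} (hx : Reduced gen x)
    (hy : ∃ i, y ∈ m (.Y i)) (h : val gen x = val gen y) : x = y := by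
  obtain ⟨i, hi⟩ := hy
  exact hx.eq_of_val_eq (I.reduced i y hi) h

theorem Base.dropLast_mem (I : Base gen m p q l) {x : Word r} {i : Fin k} (hx : x ∈ m (.Y i))
    (h : x.dropLast ≠ []) : ∃ j, x.dropLast ∈ m (.Y j) := by
  have hr := I.reduced i x hx
  refine I.mem_of_slt (hr.dropLast h) hx (slt_of_length_lt ?_)
  rw [List.length_dropLast]
  have := List.length_pos_iff.2 hr.1
  omega

theorem Inv.weaken (I : Inv gen m p q l) {q' : ℕ} (h : q ≤ q') : Inv gen m p q' l := by
  obtain ⟨⟨h1, h2, h3, h4, h5, h6, h7, h8, h9, h10, h11, h12⟩, h13⟩ := I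
  exact ⟨⟨h1, h2, h3, h4, h5, h6, h7, h8, fun j w hw => (h9 j w hw).trans_le h, h10, h11, h12⟩, h13⟩

/-- The invariant does not mention the queues; this allows them to be emptied. -/
theorem Inv.congr (I : Inv gen m p q l) (h : fragments m = fragments m') :
    Inv gen m' p q l := by
  have hY (j) : m (.Y j) = m' (.Y j) := congrArg Fragment.Y (congrFun h j)
  have hK (j) : m (.K j) = m' (.K j) := congrArg Fragment.K (congrFun h j)
  have hp (j u v) : m (.phi j u v) = m' (.phi j u v) :=
    congrFun (congrFun (congrArg Fragment.phi (congrFun h j)) u) v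
  have hD (j) : doneWords m j = doneWords m' j := by rw [doneWords, hY, hK, doneWords]
  obtain ⟨⟨h1, h2, h3, h4, h5, h6, h7, h8, h9, h10, h11, h12⟩, h13⟩ := I
  simp only [hY, hK, hp, hD] at *
  exact ⟨⟨h1, h2, h3, h4, h5, h6, h7, h8, h9, h10, h11, h12⟩, h13⟩

end Invariant

/-! ### The first phase -/

section Apply

variable {U : Type*} [Semigroup U] {r k : ℕ} {gen : Fin r → U} {b : WithOne U → Fin k} {c : ℕ}
  {j : Fin k} {m m0 : Mem r k}

/-- The owners of the locations in the first phase. -/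
def applyOwner (c : ℕ) : Loc r k → Option (Fin k)
  | .Y _ => none
  | .K i => some i
  | .Q i => some i
  | .phi i u _ => if c ≤ u.length then some i else none

theorem readable_phi_apply (c : ℕ) (j : Fin k) (u v : Word r) :
    Readable (applyOwner c) j (.phi j u v) := by
  simp only [Readable, applyOwner]
  split_ifs <;> simp

/-- For `y = f s`, the word `s` is reduced and shorter than `c`, hence done, and `v = φ(s, a)` is
stored. If `v < s a`, then `p(v)` is shorter than `c`, so its left multiple by `f` is stored too.
The memory `m` may differ from `m0` only in locations that have an owner. -/
theorem wp_deduce {y : Word r} {a : Fin r} (I : Inv gen m0 c (c + 1) c)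
    (hm : ∀ l, applyOwner c l = none → m l = m0 l)
    (hphi : ∀ u v x, m (.phi j u v) = some x →
      (∃ i, x ∈ m0 (.Y i)) ∧ val gen x = val gen (u ++ v))
    (hy : y ∈ m0 (.Y j)) (hc : y.length = c) :
    wp (applyOwner c) j (deduce c j y a) m fun z m' => m' = m ∧
      ∀ x, z = some x → (∃ i, x ∈ m0 (.Y i)) ∧ val gen x = val gen (y ++ [a]) := by
  have hred := I.reduced j y hy
  have hY (i) : m (.Y i) = m0 (.Y i) := hm _ rfl
  have hRY (i : Fin k) : Readable (applyOwner (r := r) c) j (.Y i) := .inl rfl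
  cases y with
  | nil => exact absurd rfl hred.1
  | cons f s =>
    unfold deduce
    dsimp only
    by_cases hs : s = []
    · rw [if_pos hs]
      exact wp_pure ⟨rfl, by simp⟩
    rw [if_neg hs]
    have hslen : s.length < c := by simp [← hc]
    have hspos := List.length_pos_iff.2 hs
    have hsred : Reduced gen s := Reduced.of_append_right (w := [f]) hred hs
    obtain ⟨i0, hi0⟩ := I.mem_of_slt hsred hy (slt_of_length_lt (by simp))
    refine wp_bind (wp_owner hRY ⟨i0, by rwa [hY]⟩ fun i hi => ?_)
    rw [hY] at hi
    obtain ⟨v, hv⟩ := I.dom_right i s (I.done_of_lt i s hi hslen) a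
    have hown : applyOwner (k := k) c (.phi i s [a]) = none := by
      simp [applyOwner, hslen]
    refine wp_bind (wp_getDefined (.inl hown) ((hm _ hown).trans hv) ?_)
    obtain ⟨⟨iv, hiv⟩, hval⟩ := I.phi_val _ _ _ _ hv
    have hvred := I.reduced iv v hiv
    by_cases hlt : slt v (s ++ [a])
    swap
    · rw [if_neg hlt]
      exact wp_pure ⟨rfl, by simp⟩
    rw [if_pos hlt]
    obtain ⟨l, hl, hl'⟩ := getLast?_eq_some hvred.1
    refine wp_bind (wp_require hl (wp_bind ?_))
    have hvlen := length_le_of_slt hlt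
    rw [List.length_append, List.length_singleton] at hvlen
    have hvpos := List.length_pos_iff.2 hvred.1
    have hplen : v.dropLast.length < c := by
      rw [List.length_dropLast]
      omega
    have hclen : s.length + 1 = c := by simpa using hc
    -- The lookup of the owner of `w` and of `φ(w, l(v))` is the same whether `p(v)` is empty (`w =
    -- f`) or not.
    have key : ∀ w : Word r, (∃ i, w ∈ m0 (.Y i)) → val gen w = val gen ([f] ++ v.dropLast) →
        wp (applyOwner c) j (owner w >>= fun n => if w.length < c then
            getDefined n w [l] >>= fun x => pure (some x)
          else if n = j then getPhi j w [l] else pure none) m fun z m' => m' = m ∧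
        ∀ x, z = some x → (∃ i, x ∈ m0 (.Y i)) ∧ val gen x = val gen (f :: s ++ [a]) := by
      rintro w ⟨iw, hiw⟩ hw
      -- In value, `w l(v) = f p(v) l(v) = f v = f s a`.
      have hfin : ∀ x, val gen x = val gen (w ++ [l]) →
          val gen x = val gen (f :: s ++ [a]) := by
        intro x hx
        have h1 : f :: s ++ [a] = [f] ++ (s ++ [a]) := rfl
        rw [hx, val_append, hw, ← val_append, List.append_assoc, hl', val_append, hval,
          ← val_append, h1]
      refine wp_bind (wp_owner hRY ⟨iw, by rwa [hY]⟩ fun n hn => ?_)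
      rw [hY] at hn
      by_cases hwc : w.length < c
      · rw [if_pos hwc]
        obtain ⟨x, hx⟩ := I.dom_right n w (I.done_of_lt n w hn hwc) l
        have hown : applyOwner (k := k) c (.phi n w [l]) = none := by
          simp [applyOwner, hwc]
        refine wp_bind (wp_getDefined (.inl hown) ((hm _ hown).trans hx) (wp_pure ⟨rfl, ?_⟩))
        rintro _ ⟨⟩
        obtain ⟨h1, h2⟩ := I.phi_val _ _ _ _ hx
        exact ⟨h1, hfin _ h2⟩
      · rw [if_neg hwc]
        -- For `|w| ≥ c` the cell is owned by `n`, so it may be read only if `n = j`; it may still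
        -- be undefined then, in which case nothing is deduced.
        by_cases hnj : n = j
        · rw [if_pos hnj]
          refine wp_getPhi (readable_phi_apply c j w [l]) ⟨rfl, fun x hx => ?_⟩
          obtain ⟨h1, h2⟩ := hphi _ _ _ hx
          exact ⟨h1, hfin _ h2⟩
        · rw [if_neg hnj]
          exact wp_pure ⟨rfl, by simp⟩
    refine wp_leftMultiple hRY (fun h => ?_) (fun h => ?_) fun h i hi => ?_
    · obtain ⟨i, hi⟩ := I.letters f
      exact key [f] ⟨i, hi⟩ (by rw [h, List.append_nil])
    · obtain ⟨i, hi⟩ := I.dropLast_mem hiv h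
      exact ⟨i, by rwa [hY]⟩
    · rw [hY] at hi
      obtain ⟨w, hw⟩ := I.dom_left i _ (I.done_of_lt i _ hi hplen) hplen f
      -- Here `s` is non-empty, so `c ≥ 2` and the left factor, a single letter, is shorter than
      -- `c`.
      have hown : applyOwner (k := k) c (.phi i [f] v.dropLast) = none := by
        simp only [applyOwner, List.length_singleton, ite_eq_right_iff, reduceCtorEq, imp_false]
        omega
      obtain ⟨h1, h2⟩ := I.phi_val _ _ _ _ hw
      exact ⟨.inl hown, w, (hm _ hown).trans hw, key w h1 h2⟩

/-- The effect of `ApplyGenerators` on the memory when the pairs in `S` have been dealt with. -/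
structure Applied (gen : Fin r → U) (b : WithOne U → Fin k) (c : ℕ) (j : Fin k) (m0 : Mem r k)
    (S : Word r → Fin r → Prop) (m : Mem r k) : Prop where
  unowned : ∀ l, applyOwner c l = none → m l = m0 l
  defined : ∀ u a, S u a → (∃ x, m (.phi j u [a]) = some x) ∨
    (b (val gen (u ++ [a])), u, a) ∈ m (.Q j)
  mono : ∀ u v x, m0 (.phi j u v) = some x → ∃ x', m (.phi j u v) = some x'
  phi_val : ∀ u v x, m (.phi j u v) = some x →
    (∃ i, x ∈ m0 (.Y i)) ∧ val gen x = val gen (u ++ v)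
  dom_only : ∀ u v x, m (.phi j u v) = some x →
    m0 (.phi j u v) = some x ∨ ∃ a, S u a ∧ v = [a]
  queue : ∀ i u a, (i, u, a) ∈ m (.Q j) → S u a ∧ i = b (val gen (u ++ [a])) ∧
    ∀ n, ∀ y ∈ m0 (.Y n), val gen y ≠ val gen (u ++ [a])

variable {S S' : Word r → Fin r → Prop}

theorem Applied.update_K (h : Applied gen b c j m0 S m) (n : ℕ) :
    Applied gen b c j m0 S (Function.update m (.K j) n) where
  unowned l hl := by
    have : l ≠ .K j := by
      rintro rfl
      simp [applyOwner] at hl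
    rw [Function.update_of_ne this, h.unowned l hl]
  defined := by simpa using h.defined
  mono := by simpa using h.mono
  phi_val := by simpa using h.phi_val
  dom_only := by simpa using h.dom_only
  queue := by simpa using h.queue

/-- The enlarged set of treated pairs is given only up to equivalence, so that it can be expressed
by membership in the lists of the two nested loops. -/
theorem Applied.update_phi (h : Applied gen b c j m0 S m) {y x : Word r} {a : Fin r}
    (hc : y.length = c) (hx : ∃ i, x ∈ m0 (.Y i)) (hval : val gen x = val gen (y ++ [a]))
    (hS : ∀ u a', S' u a' ↔ S u a' ∨ (u = y ∧ a' = a)) :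
    Applied gen b c j m0 S' (Function.update m (.phi j y [a]) (some x)) := by
  have hval' : ∀ u v : Word r, (u = y ∧ v = [a] ∧
        Function.update m (.phi j y [a]) (some x) (.phi j u v) = some x) ∨
      (¬ (u = y ∧ v = [a]) ∧
        Function.update m (.phi j y [a]) (some x) (.phi j u v) = m (.phi j u v)) := by
    intro u v
    by_cases huv : u = y ∧ v = [a]
    · obtain ⟨rfl, rfl⟩ := huv
      exact .inl ⟨rfl, rfl, Function.update_self ..⟩
    · refine .inr ⟨huv, Function.update_of_ne ?_ _ _⟩
      simpa using huv
  have hQ : Function.update m (.phi j y [a]) (some x) (.Q j) = m (.Q j) :=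
    Function.update_of_ne (by simp) _ _
  refine ⟨fun l hl => ?_, fun u a' hu => ?_, fun u v x' hx' => ?_, fun u v x' hx' => ?_,
    fun u v x' hx' => ?_, fun i u a' hq => ?_⟩
  · have : l ≠ .phi j y [a] := by
      rintro rfl
      simp [applyOwner, hc] at hl
    rw [Function.update_of_ne this, h.unowned l hl]
  · rw [hQ]
    rcases hval' u [a'] with ⟨-, -, h1⟩ | ⟨h0, h1⟩
    · exact .inl ⟨x, h1⟩
    · rw [h1]
      refine h.defined u a' (((hS u a').1 hu).resolve_right fun h2 => h0 ?_)
      simp [h2]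
  -- The write may replace a value stored earlier as a left multiple (when `c = 1`). Only
  -- definedness is tracked here; equality of the two values is recovered in `Inv.phi_eq`.
  · rcases hval' u v with ⟨-, -, h1⟩ | ⟨h0, h1⟩
    · exact ⟨x, h1⟩
    · rw [h1]
      exact h.mono u v x' hx'
  · rcases hval' u v with ⟨rfl, rfl, h1⟩ | ⟨h0, h1⟩
    · rw [h1] at hx'
      cases hx'
      exact ⟨hx, hval⟩
    · rw [h1] at hx'
      exact h.phi_val u v x' hx'
  · rcases hval' u v with ⟨rfl, rfl, h1⟩ | ⟨h0, h1⟩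
    · exact .inr ⟨a, (hS _ _).2 (.inr ⟨rfl, rfl⟩), rfl⟩
    · rw [h1] at hx'
      rcases h.dom_only u v x' hx' with h2 | ⟨a', h2, h3⟩
      · exact .inl h2
      · exact .inr ⟨a', (hS _ _).2 (.inl h2), h3⟩
  · rw [hQ] at hq
    obtain ⟨h1, h2⟩ := h.queue i u a' hq
    exact ⟨(hS _ _).2 (.inl h1), h2⟩

theorem Applied.update_Q (h : Applied gen b c j m0 S m) {y : Word r} {a : Fin r}
    (hy : ∀ n, ∀ x ∈ m0 (.Y n), val gen x ≠ val gen (y ++ [a]))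
    (hS : ∀ u a', S' u a' ↔ S u a' ∨ (u = y ∧ a' = a)) :
    Applied gen b c j m0 S'
      (Function.update m (.Q j) (m (.Q j) ++ [(b (val gen (y ++ [a])), y, a)])) := by
  refine ⟨fun l hl => ?_, fun u a' hu => ?_, by simpa using h.mono, by simpa using h.phi_val,
    fun u v x' hx' => ?_, fun i u a' hq => ?_⟩
  · have : l ≠ .Q j := by
      rintro rfl
      simp [applyOwner] at hl
    rw [Function.update_of_ne this, h.unowned l hl]
  · rw [Function.update_self, Function.update_of_ne (by simp), List.mem_append]
    rcases (hS u a').1 hu with h1 | ⟨rfl, rfl⟩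
    · exact (h.defined u a' h1).imp_right .inl
    · simp
  · rw [Function.update_of_ne (by simp)] at hx'
    rcases h.dom_only u v x' hx' with h2 | ⟨a', h2, h3⟩
    · exact .inl h2
    · exact .inr ⟨a', (hS _ _).2 (.inl h2), h3⟩
  · rw [Function.update_self, List.mem_append] at hq
    rcases hq with hq | hq
    · obtain ⟨h1, h2⟩ := h.queue i u a' hq
      exact ⟨(hS _ _).2 (.inl h1), h2⟩
    · simp only [List.mem_singleton, Prod.mk.injEq] at hq
      obtain ⟨rfl, rfl, rfl⟩ := hq
      exact ⟨(hS _ _).2 (.inr ⟨rfl, rfl⟩), rfl, hy⟩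

theorem wp_applyGenerator {y : Word r} {a : Fin r} (I : Inv gen m0 c (c + 1) c)
    (hy : y ∈ m0 (.Y j)) (hc : y.length = c) (h : Applied gen b c j m0 S m)
    (hS : ∀ u a', S' u a' ↔ S u a' ∨ (u = y ∧ a' = a)) :
    wp (applyOwner c) j (applyGenerator gen b c j y a) m fun _ m' =>
      Applied gen b c j m0 S' m' ∧ m' (.K j) = m (.K j) := by
  have hY (i) : m (.Y i) = m0 (.Y i) := h.unowned _ rfl
  have hown : applyOwner c (.phi j y [a]) = some j := by simp [applyOwner, hc]
  unfold applyGenerator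
  refine wp_bind (wp_mono (wp_deduce I h.unowned h.phi_val hy hc) ?_)
  rintro z m ⟨rfl, hz⟩
  cases z with
  | some x =>
    obtain ⟨h1, h2⟩ := hz x rfl
    exact wp_put hown ⟨h.update_phi hc h1 h2 hS, by simp⟩
  | none =>
    refine wp_bind (wp_readAll (fun i Q' hQ' => wp_getY (.inl rfl) hQ') ?_)
    split
    · rename_i x hx
      obtain ⟨p, hp, hp'⟩ := List.mem_flatMap.1 (List.mem_of_find?_eq_some hx)
      obtain ⟨i, -, rfl⟩ := List.mem_map.1 hp
      rw [hY] at hp'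
      exact wp_put hown ⟨h.update_phi hc ⟨i, hp'⟩ (by simpa using List.find?_some hx) hS, by simp⟩
    · rename_i hx
      rw [List.find?_eq_none] at hx
      refine wp_bind (wp_getQ (.inr rfl) (wp_put rfl ⟨h.update_Q (fun n x hn hval => ?_) hS,
        by simp⟩))
      refine hx x ?_ (by simpa using hval)
      rw [List.mem_flatMap]
      exact ⟨(n, m (.Y n)), by simp, by rwa [hY]⟩

/-- The words of length `c` that are not yet done. -/
def pending (c : ℕ) (m : Mem r k) (j : Fin k) : List (Word r) :=
  ((m (.Y j)).drop (m (.K j) - 1)).takeWhile fun y => decide (y.length = c)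

theorem mem_of_mem_pending {w : Word r} (h : w ∈ pending c m j) :
    w ∈ m (.Y j) ∧ w.length = c :=
  ⟨List.mem_of_mem_drop ((List.takeWhile_sublist _).mem h), by simpa using List.mem_takeWhile_imp h⟩

/-- The outcome of the first phase for the process `j`. -/
def ApplyPost (gen : Fin r → U) (b : WithOne U → Fin k) (c : ℕ) (m0 : Mem r k) (j : Fin k)
    (m : Mem r k) : Prop :=
  Applied gen b c j m0 (fun u _ => u ∈ pending c m0 j) m ∧
    m (.K j) = m0 (.K j) + (pending c m0 j).length

/-- Apart from unowned locations and the fixed memory `m0`, the condition mentions only `K_j`, `Q_j`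
and cells of `φ_j`, all readable by `j`. -/
theorem stable_applyPost : Stable (applyOwner c) j (ApplyPost gen b c m0 j) := by
  rintro m m' hm ⟨⟨h1, h2, h3, h4, h5, h6⟩, h7⟩
  have hK : m (.K j) = m' (.K j) := hm _ (.inr rfl)
  have hQ : m (.Q j) = m' (.Q j) := hm _ (.inr rfl)
  have hp (u v) : m (.phi j u v) = m' (.phi j u v) := hm _ (readable_phi_apply c j u v)
  simp only [hK, hQ, hp] at h2 h3 h4 h5 h6 h7
  exact ⟨⟨fun l hl => (hm l (.inl hl)).symm.trans (h1 l hl), h2, h3, h4, h5, h6⟩, h7⟩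

theorem wp_applyGenerators (I : Inv gen m0 c (c + 1) c) (hQ : m0 (.Q j) = []) :
    wp (applyOwner c) j (applyGenerators gen b c j) m0 fun _ => ApplyPost gen b c m0 j := by
  unfold applyGenerators
  refine wp_bind (wp_getY (.inl rfl) (wp_bind (wp_getK (.inr rfl) ?_)))
  refine wp_forEach (fun pre m => Applied gen b c j m0 (fun u _ => u ∈ pre) m ∧
    m (.K j) = m0 (.K j) + pre.length) ?_ ?_
  · refine ⟨⟨fun _ _ => rfl, by simp, fun u v x hx => ⟨x, hx⟩, I.phi_val j,
      fun u v x hx => .inl hx, by simp [hQ]⟩, rfl⟩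
  · rintro pre y post hxs m ⟨hA, hK⟩
    have hy : y ∈ pending c m0 j := by
      unfold pending
      rw [hxs]
      simp
    obtain ⟨hyY, hyc⟩ := mem_of_mem_pending hy
    refine wp_bind (wp_mono (wp_forEach (fun apre m => Applied gen b c j m0
      (fun u a => u ∈ pre ∨ u = y ∧ a ∈ apre) m ∧ m (.K j) = m0 (.K j) + pre.length) ?_ ?_) ?_)
    · simpa using ⟨hA, hK⟩
    · rintro apre a apost - m ⟨hA, hK⟩
      refine wp_mono (wp_applyGenerator I hyY hyc hA fun u a' => ?_) fun _ m' hm' =>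
        ⟨hm'.1, hm'.2.trans hK⟩
      simp only [List.mem_append, List.mem_singleton]
      tauto
    · rintro _ m' ⟨hA', hK'⟩
      refine wp_bind (wp_getK (.inr rfl) (wp_put rfl ⟨Applied.update_K ?_ _, ?_⟩))
      · simpa [List.mem_append] using hA'
      · rw [Function.update_self, hK', List.length_append, List.length_singleton]
        exact Nat.add_assoc _ _ _

end Apply

/-! ### Between the first and the second phase -/

section Queued

variable {U : Type*} [Semigroup U] {r k : ℕ} {gen : Fin r → U} {b : WithOne U → Fin k} {c : ℕ}
  {j : Fin k} {m m0 : Mem r k}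

/-- Memory `m'` has the data of `m` and possibly more. -/
structure Ext (m m' : Mem r k) : Prop where
  K : ∀ j, m (.K j) ≤ m' (.K j)
  Y : ∀ j, ∀ y ∈ m (.Y j), y ∈ m' (.Y j)
  done : ∀ j, ∀ y ∈ doneWords m j, y ∈ doneWords m' j
  phi : ∀ j u v x, m (.phi j u v) = some x → ∃ x', m' (.phi j u v) = some x'

theorem Ext.trans {m₁ m₂ m₃ : Mem r k} (h : Ext m₁ m₂) (h' : Ext m₂ m₃) : Ext m₁ m₃ where
  K j := (h.K j).trans (h'.K j)
  Y j y hy := h'.Y j y (h.Y j y hy)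
  done j y hy := h'.done j y (h.done j y hy)
  phi j u v x hx := by
    obtain ⟨x', hx'⟩ := h.phi j u v x hx
    exact h'.phi j u v x' hx'

/-- The state of the memory at the start of the second phase. -/
structure Queued (gen : Fin r → U) (b : WithOne U → Fin k) (c : ℕ) (m : Mem r k) : Prop
    extends Base gen m (c + 1) (c + 1) c where
  defined : ∀ j, ∀ u ∈ doneWords m j, ∀ a, (∃ x, m (.phi j u [a]) = some x) ∨
    (b (val gen (u ++ [a])), u, a) ∈ m (.Q j)
  queue : ∀ j i u a, (i, u, a) ∈ m (.Q j) → u ∈ doneWords m j ∧ u.length = c ∧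
    i = b (val gen (u ++ [a])) ∧ ∀ n, ∀ y ∈ m (.Y n), val gen y ≠ val gen (u ++ [a])

/-- Lengths are weakly increasing along a sorted list, so if none is below `c`, the words of length
`c` come first. -/
theorem mem_takeWhile_of_sorted {L : List (Word r)} (hL : L.Pairwise slt)
    (h : ∀ x ∈ L, c ≤ x.length) {w : Word r} (hw : w ∈ L) (hc : w.length ≤ c) :
    w ∈ L.takeWhile fun y => decide (y.length = c) := by
  induction L with
  | nil => exact hw
  | cons x L ih =>
    rw [List.pairwise_cons] at hL
    have hx := h x (by simp)
    have hxc : x.length = c := by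
      rcases List.mem_cons.1 hw with rfl | hw
      · omega
      · have := length_le_of_slt (hL.1 w hw)
        omega
    rw [List.takeWhile_cons_of_pos (by simpa using hxc), List.mem_cons]
    rcases List.mem_cons.1 hw with rfl | hw
    · exact .inl rfl
    · exact .inr (ih hL.2 (fun y hy => h y (by simp [hy])) hw)

theorem queued_of_applyPost (I : Inv gen m0 c (c + 1) c)
    (h : ∀ j, ApplyPost gen b c m0 j m) : Queued gen b c m ∧ Ext m0 m := by
  have hY (i) : m (.Y i) = m0 (.Y i) := (h i).1.unowned _ rfl
  have hpre (i) : pending c m0 i <+: (m0 (.Y i)).drop (m0 (.K i) - 1) := List.takeWhile_prefix _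
  have hK (i) : m (.K i) = m0 (.K i) + (pending c m0 i).length := (h i).2
  have hdone (i) : doneWords m i = doneWords m0 i ++ pending c m0 i := by
    have h1 : m (.K i) - 1 = (m0 (.K i) - 1) + (pending c m0 i).length := by
      have h1 := I.one_le i
      rw [hK i]
      exact Nat.sub_add_comm h1
    rw [doneWords, h1, hY, List.take_add, ← List.prefix_iff_eq_take.1 (hpre i)]
    rfl
  have hmono (i) {w} (hw : w ∈ doneWords m0 i) : w ∈ doneWords m i := by
    rw [hdone]
    exact List.mem_append_left _ hw
  refine ⟨⟨⟨by simpa only [hY] using I.sorted, by simpa only [hY] using I.disjoint,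
    by simpa only [hY] using I.reduced, by simpa only [hY] using I.letters,
    by simpa only [hY] using I.initial, fun i => ?_, fun i => ?_, fun i w hw hwc => ?_,
    fun i w hw => ?_, fun i u v x hx => ?_, fun i v hv hvc a => ?_, fun i u v x hx => ?_⟩,
    fun i u hu a => ?_, fun i n u a hq => ?_⟩, fun i => ?_, fun i => ?_,
    fun i y hy => hmono i hy, fun i => (h i).1.mono⟩
  · rw [hK]
    exact Nat.le_add_right_of_le (I.one_le i)
  · have h1 := I.one_le i
    have h2 := I.le i
    have h3 := (hpre i).length_le
    rw [List.length_drop] at h3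
    have aux : ∀ K N a : ℕ, 1 ≤ K → K ≤ N + 1 → a ≤ N - (K - 1) → K + a ≤ N + 1 := by omega
    rw [hY, hK]
    exact aux _ _ _ h1 h2 h3
  · rw [hY] at hw
    rw [hdone, List.mem_append]
    have hw' := hw
    rw [← List.take_append_drop (m0 (.K i) - 1) (m0 (.Y i)), List.mem_append] at hw'
    refine hw'.imp_right fun hw' => ?_
    have hs := I.sorted i
    rw [← List.take_append_drop (m0 (.K i) - 1) (m0 (.Y i)), List.pairwise_append] at hs
    refine mem_takeWhile_of_sorted hs.2.1 (fun x hx => ?_) hw' (Nat.lt_succ_iff.1 hwc)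
    -- A word shorter than `c` is done, so it would occur both before and after the cut in a
    -- strictly increasing list.
    by_contra hxc
    exact slt_irrefl x (hs.2.2 x (I.done_of_lt i x (List.mem_of_mem_drop hx) (not_le.1 hxc)) x hx)
  · rw [hdone, List.mem_append] at hw
    rcases hw with hw | hw
    · exact I.lt_of_done i w hw
    · rw [(mem_of_mem_pending hw).2]
      exact Nat.lt_succ_self c
  · simpa only [hY] using (h i).1.phi_val u v x hx
  · rw [hdone, List.mem_append] at hv
    rcases hv with hv | hv
    · obtain ⟨x, hx⟩ := I.dom_left i v hv hvc a
      exact (h i).1.mono _ _ _ hx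
    · exact absurd (mem_of_mem_pending hv).2 hvc.ne
  · rcases (h i).1.dom_only u v x hx with h1 | ⟨a, h1, rfl⟩
    · exact (I.dom_only i u v x h1).imp (.imp_right (hmono i)) (.imp_left (hmono i))
    · refine .inr ⟨?_, a, rfl⟩
      rw [hdone]
      exact List.mem_append_right _ h1
  · rw [hdone, List.mem_append] at hu
    rcases hu with hu | hu
    · obtain ⟨x, hx⟩ := I.dom_right i u hu a
      exact .inl ((h i).1.mono _ _ _ hx)
    · exact (h i).1.defined u a hu
  · obtain ⟨h1, h2, h3⟩ := (h i).1.queue n u a hq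
    rw [hdone]
    exact ⟨List.mem_append_right _ h1, (mem_of_mem_pending h1).2, h2, by simpa only [hY] using h3⟩
  · rw [hK]
    exact Nat.le_add_right _ _
  · rw [hY]
    exact fun y hy => hy

/-- Every new reduced word that does not exceed all products of words of length `c` and letters
has been queued. -/
theorem Queued.mem_queue (I : Queued gen b c m) {x w : Word r} {a : Fin r} {i : Fin k}
    (hx : Reduced gen x) (hxY : ∀ n, x ∉ m (.Y n)) (hw : w ∈ m (.Y i)) (hwc : w.length = c)
    (hle : x = w ++ [a] ∨ slt x (w ++ [a])) :
    ∃ n x' l, x = x' ++ [l] ∧ (b (val gen x), x', l) ∈ m (.Q n) := by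
  obtain ⟨l, -, hl⟩ := getLast?_eq_some hx.1
  -- All letters are already in the lists, so the new word `x` is not a letter.
  have hne : x.dropLast ≠ [] := by
    intro h0
    rw [h0] at hl
    obtain ⟨n, hn⟩ := I.letters l
    exact hxY n (hl ▸ hn)
  have hlen : x.length ≤ c + 1 := by
    have h1 : (w ++ [a]).length = c + 1 := by simp [hwc]
    rcases hle with rfl | hle
    · exact h1.le
    · exact h1 ▸ length_le_of_slt hle
  have hdlen : x.dropLast.length ≤ c := by
    rw [List.length_dropLast]
    omega
  have hdred := hx.dropLast hne
  obtain ⟨n, hn⟩ : ∃ n, x.dropLast ∈ m (.Y n) := by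
    -- A prefix of `x` greater than `w` would make `x` greater than `w a`.
    rcases slt_trichotomy x.dropLast w with h1 | h1 | h1
    · exact I.mem_of_slt hdred hw h1
    · exact ⟨i, h1 ▸ hw⟩
    · have h2 : slt (w ++ [a]) (x.dropLast ++ [l]) := slt_append h1 rfl
      rw [hl] at h2
      rcases hle with rfl | hle
      · exact absurd h2 (slt_irrefl _)
      · exact absurd h2 (slt_asymm hle)
  -- A stored product of `p(x)` and `l(x)` would be a known reduced word with the value of `x`, that
  -- is, `x` itself; so the product has been queued.
  rcases I.defined n _ (I.done_of_lt n _ hn (Nat.lt_succ_of_le hdlen)) l with ⟨y, hy⟩ | hq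
  · obtain ⟨h1, h2⟩ := I.phi_val _ _ _ _ hy
    rw [hl] at h2
    obtain ⟨i', hi'⟩ := h1
    rw [← I.eq_of_val_eq hx ⟨i', hi'⟩ h2.symm] at hi'
    exact absurd hi' (hxY i')
  · rw [hl] at hq
    exact ⟨n, _, l, hl.symm, hq⟩

end Queued

/-! ### The second phase -/

section SecondPhase

variable {U : Type*} [Semigroup U] {r k : ℕ} {gen : Fin r → U} {b : WithOne U → Fin k} {c : ℕ}
  {j : Fin k} {m m0 m' : Mem r k}

/-- The owners of the locations in the second phase. -/
def processOwner (gen : Fin r → U) (b : WithOne U → Fin k) : Loc r k → Option (Fin k)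
  | .Y i => some i
  | .K _ => none
  | .Q _ => none
  | .phi _ u v => some (b (val gen (u ++ v)))

/-- The effect of `ProcessQueues` when the entries in `pre` have been dealt with. -/
structure Processed (gen : Fin r → U) (b : WithOne U → Fin k) (j : Fin k) (m0 : Mem r k)
    (pre : List (Fin k × Fin k × Word r × Fin r)) (m : Mem r k) : Prop where
  unowned : ∀ l, processOwner gen b l = none → m l = m0 l
  le_Y : m0 (.Y j) <+: m (.Y j)
  sorted : (m (.Y j)).Pairwise slt
  new : ∀ y ∈ m (.Y j), y ∈ m0 (.Y j) ∨ (Reduced gen y ∧ b (val gen y) = j ∧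
    ∃ n i w a, (n, i, w, a) ∈ pre ∧ y = w ++ [a])
  defined : ∀ n i w a, (n, i, w, a) ∈ pre → b (val gen (w ++ [a])) = j →
    ∃ y ∈ m (.Y j), val gen y = val gen (w ++ [a]) ∧ m (.phi n w [a]) = some y
  mono : ∀ n u v, b (val gen (u ++ v)) = j → ∀ x, m0 (.phi n u v) = some x →
    ∃ x', m (.phi n u v) = some x'
  phi : ∀ n u v, b (val gen (u ++ v)) = j → ∀ x, m (.phi n u v) = some x →
    m0 (.phi n u v) = some x ∨ (x ∈ m (.Y j) ∧ val gen x = val gen (u ++ v) ∧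
      ∃ i a, (n, i, u, a) ∈ pre ∧ v = [a])

/-- A cell `φ_n(u, v)` belongs to the process `b(uv)` and not to `n`; for this reason the clauses on
cells are restricted to products assigned to `j`. -/
theorem stable_processed {pre : List (Fin k × Fin k × Word r × Fin r)} :
    Stable (processOwner gen b) j (Processed gen b j m0 pre) := by
  rintro m m' hm ⟨h1, h2, h3, h4, h5, h6, h7⟩
  have hY : m (.Y j) = m' (.Y j) := hm _ (.inr rfl)
  have hp (n u v) (h : b (val gen (u ++ v)) = j) : m (.phi n u v) = m' (.phi n u v) :=
    hm _ (.inr (congrArg some h))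
  rw [hY] at h2 h3
  simp only [hY] at h4 h5 h7
  refine ⟨fun l hl => (hm l (.inl hl)).symm.trans (h1 l hl), h2, h3, h4, fun n i w a hq hj => ?_,
    fun n u v hj => ?_, fun n u v hj => ?_⟩
  · rw [← hp _ _ _ hj]
    exact h5 n i w a hq hj
  · rw [← hp _ _ _ hj]
    exact h6 n u v hj
  · rw [← hp _ _ _ hj]
    exact h7 n u v hj

variable {pre : List (Fin k × Fin k × Word r × Fin r)} {n i : Fin k} {w y : Word r} {a : Fin r}

theorem Processed.skip (h : Processed gen b j m0 pre m) (hj : b (val gen (w ++ [a])) ≠ j) :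
    Processed gen b j m0 (pre ++ [(n, i, w, a)]) m := by
  obtain ⟨h1, h2, h3, h4, h5, h6, h7⟩ := h
  refine ⟨h1, h2, h3, fun y hy => ?_, fun n' i' w' a' hq hj' => ?_, h6, fun n' u v hj' x hx => ?_⟩
  · rcases h4 y hy with h | ⟨h, h', n', i', w', a', hq, hy⟩
    · exact .inl h
    · exact .inr ⟨h, h', n', i', w', a', List.mem_append_left _ hq, hy⟩
  · rw [List.mem_append, List.mem_singleton] at hq
    rcases hq with hq | hq
    · exact h5 n' i' w' a' hq hj'
    · simp only [Prod.mk.injEq] at hq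
      obtain ⟨-, -, rfl, rfl⟩ := hq
      exact absurd hj' hj
  · rcases h7 n' u v hj' x hx with h | ⟨h, h', i', a', hq, hv⟩
    · exact .inl h
    · exact .inr ⟨h, h', i', a', List.mem_append_left _ hq, hv⟩

/-- Covers both branches of the loop body: the value is found in `Y_j`, or the queued word is
appended to `Y_j`. -/
theorem Processed.step (h : Processed gen b j m0 pre m)
    (hu : ∀ l, processOwner gen b l = none → m' l = m l) (hpre : m (.Y j) <+: m' (.Y j))
    (hs : (m' (.Y j)).Pairwise slt)
    (hnew : ∀ y ∈ m' (.Y j), y ∈ m (.Y j) ∨ (Reduced gen y ∧ b (val gen y) = j ∧ y = w ++ [a]))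
    (hy : y ∈ m' (.Y j)) (hval : val gen y = val gen (w ++ [a]))
    (hphi : m' (.phi n w [a]) = some y)
    (hphi' : ∀ n' u v, ¬ (n' = n ∧ u = w ∧ v = [a]) → m' (.phi n' u v) = m (.phi n' u v)) :
    Processed gen b j m0 (pre ++ [(n, i, w, a)]) m' := by
  obtain ⟨h1, h2, h3, h4, h5, h6, h7⟩ := h
  refine ⟨fun l hl => (hu l hl).trans (h1 l hl), h2.trans hpre, hs, fun z hz => ?_,
    fun n' i' w' a' hq hj => ?_, fun n' u v hj x hx => ?_, fun n' u v hj x hx => ?_⟩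
  · rcases hnew z hz with hz | ⟨hr, hj, hz⟩
    · rcases h4 z hz with h | ⟨h, h', n', i', w', a', hq, hz⟩
      · exact .inl h
      · exact .inr ⟨h, h', n', i', w', a', List.mem_append_left _ hq, hz⟩
    · exact .inr ⟨hr, hj, n, i, w, a, by simp, hz⟩
  · by_cases hc : n' = n ∧ w' = w ∧ [a'] = [a]
    · obtain ⟨rfl, rfl, ha⟩ := hc
      rw [ha]
      exact ⟨y, hy, hval, hphi⟩
    · rw [hphi' _ _ _ hc]
      rw [List.mem_append, List.mem_singleton] at hq
      rcases hq with hq | hq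
      · obtain ⟨z, hz, hz'⟩ := h5 n' i' w' a' hq hj
        exact ⟨z, hpre.subset hz, hz'⟩
      · simp only [Prod.mk.injEq] at hq
        exact absurd ⟨hq.1, hq.2.2.1, by rw [hq.2.2.2]⟩ hc
  · by_cases hc : n' = n ∧ u = w ∧ v = [a]
    · obtain ⟨rfl, rfl, rfl⟩ := hc
      exact ⟨y, hphi⟩
    · rw [hphi' _ _ _ hc]
      exact h6 n' u v hj x hx
  · by_cases hc : n' = n ∧ u = w ∧ v = [a]
    · obtain ⟨rfl, rfl, rfl⟩ := hc
      rw [hphi] at hx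
      cases hx
      exact .inr ⟨hy, hval, i, a, by simp, rfl⟩
    · rw [hphi' _ _ _ hc] at hx
      rcases h7 n' u v hj x hx with h | ⟨h, h', i', a', hq, hv⟩
      · exact .inl h
      · exact .inr ⟨hpre.subset h, h', i', a', List.mem_append_left _ hq, hv⟩

/-- All queued words in the order in which they are processed. -/
noncomputable def queuedWords (m : Mem r k) : List (Fin k × Fin k × Word r × Fin r) :=
  sortQueues ((List.finRange k).map fun i => (i, m (.Q i)))

theorem mem_queuedWords : (n, i, w, a) ∈ queuedWords m ↔ (i, w, a) ∈ m (.Q n) := by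
  simp [queuedWords, sortQueues]

theorem queuedWords_pairwise (m : Mem r k) : (queuedWords m).Pairwise fun e e' =>
    ¬ slt (e'.2.2.1 ++ [e'.2.2.2]) (e.2.2.1 ++ [e.2.2.2]) := by
  unfold queuedWords sortQueues
  refine (List.pairwise_mergeSort (fun e e' e'' h h' => ?_) (fun e e' => ?_) _).imp
    fun h => by simpa only [decide_eq_true_eq] using h
  · simp only [decide_eq_true_eq] at *
    intro h2
    rcases slt_trichotomy (e'.2.2.1 ++ [e'.2.2.2]) (e.2.2.1 ++ [e.2.2.2]) with h1 | h1 | h1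
    · exact h h1
    · exact h' (h1 ▸ h2)
    · exact h' (slt_trans h2 h1)
  · simp only [Bool.or_eq_true, decide_eq_true_eq, ← not_and_or]
    exact fun h => slt_asymm h.1 h.2

/-- All queued words with the same value are treated by the same process, in increasing order; so
the first of them to be met is the reduced one, and the later ones find it in `Y_j`. -/
theorem wp_processQueues (I : Queued gen b c m0) :
    wp (processOwner gen b) j (processQueues gen j) m0 fun _ =>
      Processed gen b j m0 (queuedWords m0) := by
  unfold processQueues
  refine wp_bind (wp_readAll (g := fun i => m0 (.Q i)) (fun i Q' hQ' => wp_getQ (.inl rfl) hQ') ?_)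
  change wp _ _ (forEach _ (queuedWords m0)) _ _
  refine wp_forEach (fun pre m => Processed gen b j m0 pre m)
    ⟨fun _ _ => rfl, List.prefix_rfl, I.sorted j, fun y hy => .inl hy, by simp,
      fun n u v _ x hx => ⟨x, hx⟩, fun n u v _ x hx => .inl hx⟩ ?_
  rintro pre ⟨n, i, w, a⟩ post hxs m h
  have hpost : (n, i, w, a) ∈ queuedWords m0 := by simp [hxs]
  have hpw := queuedWords_pairwise m0
  rw [hxs, List.pairwise_append, List.pairwise_cons] at hpw
  obtain ⟨-, ⟨hpw1, -⟩, hpw2⟩ := hpw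
  obtain ⟨hwd, hwc, rfl, hwY⟩ := I.queue n i w a (mem_queuedWords.1 hpost)
  dsimp only
  by_cases hj : b (val gen (w ++ [a])) = j
  swap
  · rw [if_neg hj]
    exact wp_pure (h.skip hj)
  rw [if_pos hj]
  have hown : processOwner gen b (.phi n w [a]) = some j := congrArg some hj
  refine wp_bind (wp_getY (.inr rfl) ?_)
  split
  · rename_i y hy
    refine wp_put hown (h.step (fun l hl => Function.update_of_ne ?_ _ _) (by simp)
      (by simpa using h.sorted) (by simp +contextual) (y := y) ?_ ?_ (by simp) ?_)
    · rintro rfl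
      simp [hown] at hl
    · simpa using List.mem_of_find?_eq_some hy
    · simpa using List.find?_some hy
    · intro n' u v hc
      exact Function.update_of_ne (by simpa using hc) _ _
  · rename_i hnone
    rw [List.find?_eq_none] at hnone
    replace hnone : ∀ y ∈ m (.Y j), val gen y ≠ val gen (w ++ [a]) := by simpa using hnone
    -- The reduced form `x ≤ w a` is new, hence queued, and assigned to `j`. Had it been treated
    -- before, its value would be in `Y_j`; if it is the present entry or comes later in the sorted
    -- queue, it equals `w a`.
    have hred : Reduced gen (w ++ [a]) := by
      obtain ⟨x, hx, hval⟩ := exists_reduced gen (w := w ++ [a]) (by simp)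
      have hle := hx.2 (w ++ [a]) (by simp) hval.symm
      obtain ⟨n', x', l, hx', hq⟩ := I.mem_queue hx (fun n' hn' => hwY n' x hn' hval)
        (mem_of_mem_doneWords hwd) hwc (hle.imp Eq.symm id)
      have hmem := mem_queuedWords.2 hq
      rw [hxs, List.mem_append, List.mem_cons] at hmem
      rcases hmem with hmem | hmem | hmem
      · obtain ⟨y, hy, hy', -⟩ := h.defined _ _ _ _ hmem (by rw [← hx', hval, hj])
        exact absurd (by rw [hy', ← hx', hval]) (hnone y hy)
      · simp only [Prod.mk.injEq] at hmem
        rw [← hmem.2.2.1, ← hmem.2.2.2, ← hx']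
        exact hx
      · have h1 := hpw1 _ hmem
        dsimp only at h1
        rw [← hx'] at h1
        rcases hle with hle | hle
        · rwa [hle]
        · exact absurd hle h1
    refine wp_bind (wp_put rfl (wp_put hown (h.step (fun l hl => ?_) ?_ ?_ ?_ ?_ rfl
      (Function.update_self ..) ?_)))
    · rw [Function.update_of_ne, Function.update_of_ne]
      · rintro rfl
        simp [processOwner] at hl
      · rintro rfl
        simp [hown] at hl
    · rw [Function.update_of_ne (by simp), Function.update_self]
      exact List.prefix_append _ _
    · rw [Function.update_of_ne (by simp), Function.update_self, List.pairwise_append]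
      -- Old words are smaller than `w a`, because it is a reduced word outside their initial
      -- segment; words added in this phase are smaller because the queue is sorted and their values
      -- differ from that of `w a`.
      refine ⟨h.sorted, by simp, fun y hy z hz => ?_⟩
      rw [List.mem_singleton.1 hz]
      rcases h.new y hy with hy' | ⟨-, -, n', i', w', a', hq, rfl⟩
      · refine (I.initial _ hred).resolve_left ?_ j y hy'
        rintro ⟨n', hn'⟩
        exact hwY n' _ hn' rfl
      · rcases slt_trichotomy (w' ++ [a']) (w ++ [a]) with h1 | h1 | h1
        · exact h1
        · exact absurd (by rw [h1]) (hnone _ hy)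
        · exact absurd h1 (hpw2 _ hq (n, _, w, a) List.mem_cons_self)
    · rw [Function.update_of_ne (by simp), Function.update_self]
      intro y hy
      rcases List.mem_append.1 hy with hy | hy
      · exact .inl hy
      · rw [List.mem_singleton.1 hy]
        exact .inr ⟨hred, hj, rfl⟩
    · rw [Function.update_of_ne (by simp), Function.update_self]
      simp
    · intro n' u v hc
      rw [Function.update_of_ne (by simpa using hc), Function.update_of_ne (by simp)]

theorem inv_of_processed (I : Queued gen b c m0)
    (h : ∀ j, Processed gen b j m0 (queuedWords m0) m) :
    Inv gen m (c + 1) (c + 1) c ∧ Ext m0 m := by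
  have hK (i) : m (.K i) = m0 (.K i) := (h i).unowned _ rfl
  have hY {i y} (hy : y ∈ m0 (.Y i)) : y ∈ m (.Y i) := (h i).le_Y.subset hy
  -- Words are only appended and `K_i` does not change, so the done part is unaffected.
  have hdone (i) : doneWords m i = doneWords m0 i := by
    obtain ⟨L, hL⟩ := (h i).le_Y
    rw [doneWords, doneWords, ← hL, hK, List.take_append_of_le_length]
    exact Nat.sub_le_of_le_add (I.le i)
  have hnew (i y) (hy : y ∈ m (.Y i)) : y ∈ m0 (.Y i) ∨ (Reduced gen y ∧ b (val gen y) = i ∧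
      (∀ n, y ∉ m0 (.Y n)) ∧ y.length = c + 1 ∧ ∃ w a, y = w ++ [a] ∧ w.length = c ∧
        ∃ n, w ∈ m0 (.Y n)) := by
    rcases (h i).new y hy with hy | ⟨h1, h2, n, i', w, a, hq, rfl⟩
    · exact .inl hy
    · obtain ⟨h3, h4, -, h5⟩ := I.queue _ _ _ _ (mem_queuedWords.1 hq)
      exact .inr ⟨h1, h2, fun n hn => h5 n _ hn rfl, by simp [h4], w, a, rfl, h4, n,
        mem_of_mem_doneWords h3⟩
  have hmono (i u v x) (hx : m0 (.phi i u v) = some x) : ∃ x', m (.phi i u v) = some x' :=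
    (h _).mono i u v rfl x hx
  refine ⟨⟨⟨fun i => (h i).sorted, fun i i' w hw hw' => ?_, fun i y hy => ?_, fun a => ?_,
    fun x hx => ?_, fun i => ?_, fun i => ?_, fun i w hw hwc => ?_, fun i w hw => ?_,
    fun i u v x hx => ?_, fun i v hv hvc a => ?_, fun i u v x hx => ?_⟩, fun i u hu a => ?_⟩,
    fun i => (hK i).ge, fun i y => hY, fun i => by rw [hdone]; exact fun y hy => hy, hmono⟩
  -- A new word is in no old list, and its value determines through `b` the only list that it can
  -- join.
  · rcases hnew i w hw with h1 | ⟨-, h1, h1', -⟩ <;> rcases hnew i' w hw' with h2 | ⟨-, h2, h2', -⟩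
    · exact I.disjoint i i' w h1 h2
    · exact absurd h1 (h2' i)
    · exact absurd h2 (h1' i')
    · exact h1.symm.trans h2
  · rcases hnew i y hy with h1 | h1
    · exact I.reduced i y h1
    · exact h1.1
  · obtain ⟨i, hi⟩ := I.letters a
    exact ⟨i, hY hi⟩
  -- A missing reduced word below a new word `w a` has been queued by `Queued.mem_queue`, and
  -- processing it put a reduced word of the same value, hence the word itself, into a list.
  · by_contra! hcon
    obtain ⟨hxY, i, y, hy, hxy⟩ := hcon
    have hxY0 : ∀ n, x ∉ m0 (.Y n) := fun n hn => hxY n (hY hn)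
    rcases hnew i y hy with h1 | ⟨-, -, -, -, w, a, rfl, hwc, n, hw⟩
    · rcases I.initial x hx with ⟨n, hn⟩ | h2
      · exact hxY0 n hn
      · exact hxy (h2 i y h1)
    · have hle : x = w ++ [a] ∨ slt x (w ++ [a]) := by
        rcases slt_trichotomy x (w ++ [a]) with h1 | h1 | h1
        · exact .inr h1
        · exact .inl h1
        · exact absurd h1 hxy
      obtain ⟨n', x', l, hx', hq⟩ := I.mem_queue hx hxY0 hw hwc hle
      obtain ⟨z, hz, hz', -⟩ := (h _).defined _ _ _ _ (mem_queuedWords.2 hq) (by rw [← hx'])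
      rw [← hx'] at hz'
      have hzr : Reduced gen z := by
        rcases hnew _ z hz with h1 | h1
        · exact I.reduced _ z h1
        · exact h1.1
      rw [hzr.eq_of_val_eq hx hz'] at hz
      exact hxY _ hz
  · rw [hK]
    exact I.one_le i
  · rw [hK]
    exact (I.le i).trans (Nat.add_le_add_right (h i).le_Y.length_le 1)
  · rw [hdone]
    rcases hnew i w hw with h1 | ⟨-, -, -, h1, -⟩
    · exact I.done_of_lt i w h1 hwc
    · exact absurd h1 hwc.ne
  · rw [hdone] at hw
    exact I.lt_of_done i w hw
  · rcases (h _).phi i u v rfl x hx with h1 | ⟨h1, h2, -⟩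
    · obtain ⟨⟨n, hn⟩, h3⟩ := I.phi_val i u v x h1
      exact ⟨⟨n, hY hn⟩, h3⟩
    · exact ⟨⟨_, h1⟩, h2⟩
  · rw [hdone] at hv
    obtain ⟨x, hx⟩ := I.dom_left i v hv hvc a
    exact hmono _ _ _ _ hx
  · rw [hdone]
    rcases (h _).phi i u v rfl x hx with h1 | ⟨-, -, n, a, hq, rfl⟩
    · exact I.dom_only i u v x h1
    · exact .inr ⟨(I.queue _ _ _ _ (mem_queuedWords.1 hq)).1, a, rfl⟩
  · rw [hdone] at hu
    rcases I.defined i u hu a with ⟨x, hx⟩ | hq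
    · exact hmono _ _ _ _ hx
    · obtain ⟨y, -, -, hy⟩ := (h _).defined _ _ _ _ (mem_queuedWords.2 hq) rfl
      exact ⟨y, hy⟩

end SecondPhase

/-! ### The third phase -/

section Extend

variable {U : Type*} [Semigroup U] {r k : ℕ} {gen : Fin r → U} {c : ℕ} {j : Fin k}
  {m m0 : Mem r k} {S S' : Word r → Fin r → Prop}

open Classical in
/-- The owners of the locations in the third phase. -/
noncomputable def extendOwner (c : ℕ) (m0 : Mem r k) : Loc r k → Option (Fin k)
  | .Y _ => none
  | .K _ => none
  | .Q _ => none
  | .phi i _ v => if v ∈ m0 (.Y i) ∧ c ≤ v.length then some i else none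

theorem readable_phi_extend (c : ℕ) (m0 : Mem r k) (j : Fin k) (u v : Word r) :
    Readable (extendOwner c m0) j (.phi j u v) := by
  simp only [Readable, extendOwner]
  split_ifs <;> simp

/-- The effect of the third phase when the pairs in `S` have been dealt with. -/
structure Extended (gen : Fin r → U) (c : ℕ) (j : Fin k) (m0 : Mem r k)
    (S : Word r → Fin r → Prop) (m : Mem r k) : Prop where
  unowned : ∀ l, extendOwner c m0 l = none → m l = m0 l
  defined : ∀ v a, S v a → ∃ x, m (.phi j [a] v) = some x
  mono : ∀ u v x, m0 (.phi j u v) = some x → ∃ x', m (.phi j u v) = some x'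
  phi_val : ∀ u v x, m (.phi j u v) = some x →
    (∃ i, x ∈ m0 (.Y i)) ∧ val gen x = val gen (u ++ v)
  dom_only : ∀ u v x, m (.phi j u v) = some x →
    m0 (.phi j u v) = some x ∨ ∃ a, u = [a] ∧ S v a

theorem stable_extended : Stable (extendOwner c m0) j (Extended gen c j m0 S) := by
  rintro m m' hm ⟨h1, h2, h3, h4, h5⟩
  have hp (u v) : m (.phi j u v) = m' (.phi j u v) := hm _ (readable_phi_extend c m0 j u v)
  simp only [hp] at h2 h3 h4 h5
  exact ⟨fun l hl => (hm l (.inl hl)).symm.trans (h1 l hl), h2, h3, h4, h5⟩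

theorem Extended.update_phi (h : Extended gen c j m0 S m) {y x : Word r} {a : Fin r}
    (hown : extendOwner c m0 (.phi j [a] y) = some j) (hx : ∃ i, x ∈ m0 (.Y i))
    (hval : val gen x = val gen ([a] ++ y))
    (hS : ∀ v a', S' v a' ↔ S v a' ∨ (v = y ∧ a' = a)) :
    Extended gen c j m0 S' (Function.update m (.phi j [a] y) (some x)) := by
  have hval' : ∀ u v : Word r, (u = [a] ∧ v = y ∧
        Function.update m (.phi j [a] y) (some x) (.phi j u v) = some x) ∨
      (¬ (u = [a] ∧ v = y) ∧
        Function.update m (.phi j [a] y) (some x) (.phi j u v) = m (.phi j u v)) := by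
    intro u v
    by_cases huv : u = [a] ∧ v = y
    · obtain ⟨rfl, rfl⟩ := huv
      exact .inl ⟨rfl, rfl, Function.update_self ..⟩
    · refine .inr ⟨huv, Function.update_of_ne ?_ _ _⟩
      simpa using huv
  refine ⟨fun l hl => ?_, fun v a' hv => ?_, fun u v x' hx' => ?_, fun u v x' hx' => ?_,
    fun u v x' hx' => ?_⟩
  · have : l ≠ .phi j [a] y := by
      rintro rfl
      simp [hown] at hl
    rw [Function.update_of_ne this, h.unowned l hl]
  · rcases hval' [a'] v with ⟨-, -, h1⟩ | ⟨h0, h1⟩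
    · exact ⟨x, h1⟩
    · rw [h1]
      refine h.defined v a' (((hS v a').1 hv).resolve_right fun h2 => h0 ?_)
      simp [h2]
  · rcases hval' u v with ⟨-, -, h1⟩ | ⟨h0, h1⟩
    · exact ⟨x, h1⟩
    · rw [h1]
      exact h.mono u v x' hx'
  · rcases hval' u v with ⟨rfl, rfl, h1⟩ | ⟨h0, h1⟩
    · rw [h1] at hx'
      cases hx'
      exact ⟨hx, hval⟩
    · rw [h1] at hx'
      exact h.phi_val u v x' hx'
  · rcases hval' u v with ⟨rfl, rfl, h1⟩ | ⟨h0, h1⟩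
    · exact .inr ⟨a, rfl, (hS _ _).2 (.inr ⟨rfl, rfl⟩)⟩
    · rw [h1] at hx'
      rcases h.dom_only u v x' hx' with h2 | ⟨a', h2, h3⟩
      · exact .inl h2
      · exact .inr ⟨a', h2, (hS _ _).2 (.inl h3)⟩

/-- Writing `y = p l`, the product `a y` is obtained as `φ(a, p) l`: the left multiple of the
shorter word `p` is known, and so are all right multiples of words of length at most `c`. -/
theorem wp_extendLeft_step {y : Word r} {a : Fin r} (I : Inv gen m0 (c + 1) (c + 1) c)
    (hy : y ∈ doneWords m0 j) (hc : c ≤ y.length) (h : Extended gen c j m0 S m)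
    (hS : ∀ v a', S' v a' ↔ S v a' ∨ (v = y ∧ a' = a)) :
    wp (extendOwner c m0) j (do
      let l ← require y.getLast?
      let w ← leftMultiple a y.dropLast
      let n ← owner w
      let x ← getDefined n w [l]
      put (.phi j [a] y) (some x)) m fun _ m' => Extended gen c j m0 S' m' := by
  have hY (i) : m (.Y i) = m0 (.Y i) := h.unowned _ rfl
  have hRY (i : Fin k) : Readable (extendOwner c m0) j (.Y i) := .inl rfl
  have hyY := mem_of_mem_doneWords hy
  have hylen : y.length = c := le_antisymm (Nat.lt_succ_iff.1 (I.lt_of_done j y hy)) hc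
  have hyred := I.reduced j y hyY
  have hown : extendOwner c m0 (.phi j [a] y) = some j := if_pos ⟨hyY, hc⟩
  obtain ⟨l, hl, hl'⟩ := getLast?_eq_some hyred.1
  have hpos := List.length_pos_iff.2 hyred.1
  have hdlen : y.dropLast.length < c := by
    rw [List.length_dropLast]
    omega
  have key : ∀ w : Word r, (∃ i, w ∈ m0 (.Y i)) → val gen w = val gen ([a] ++ y.dropLast) →
      wp (extendOwner c m0) j (owner w >>= fun n => getDefined n w [l] >>= fun x =>
        put (.phi j [a] y) (some x)) m fun _ m' => Extended gen c j m0 S' m' := by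
    rintro w ⟨iw, hiw⟩ hw
    -- The word `w` is reduced with the value of `a p(y)`, so it is no longer than that word, whose
    -- length is `c`.
    have hwlen : w.length < c + 1 := by
      have h1 := (I.reduced iw w hiw).length_le (v := [a] ++ y.dropLast) (by simp) hw.symm
      rw [List.length_append, List.length_singleton] at h1
      omega
    refine wp_bind (wp_owner hRY ⟨iw, by rwa [hY]⟩ fun n hn => ?_)
    rw [hY] at hn
    obtain ⟨x, hx⟩ := I.dom_right n w (I.done_of_lt n w hn hwlen) l
    obtain ⟨hread, x, hx, hx1, hx2⟩ : Readable (extendOwner c m0) j (.phi n w [l]) ∧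
        ∃ x, m (.phi n w [l]) = some x ∧ (∃ i, x ∈ m0 (.Y i)) ∧
          val gen x = val gen (w ++ [l]) := by
      by_cases hnj : n = j
      · subst hnj
        obtain ⟨x', hx'⟩ := h.mono _ _ _ hx
        exact ⟨readable_phi_extend c m0 n w [l], x', hx', h.phi_val _ _ _ hx'⟩
      · have hnone : extendOwner c m0 (.phi n w [l]) = none := by
          -- The cell `φ_n(w, l)` could have an owner only if `l ∈ Y_n` and `c = 1`; but then `y =
          -- l` lies in `Y_j`, which forces `n = j`.
          refine if_neg fun ⟨h1, h2⟩ => hnj (I.disjoint n j [l] h1 ?_)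
          rw [List.length_singleton] at h2
          have h3 : y.dropLast = [] := List.length_eq_zero_iff.1 (by omega)
          rw [h3, List.nil_append] at hl'
          rwa [hl']
        exact ⟨.inl hnone, x, (h.unowned _ hnone).trans hx, I.phi_val _ _ _ _ hx⟩
    refine wp_bind (wp_getDefined hread hx (wp_put hown (h.update_phi hown hx1 ?_ hS)))
    rw [hx2, val_append, hw, ← val_append, List.append_assoc, hl']
  refine wp_bind (wp_require hl (wp_bind (wp_leftMultiple hRY (fun h0 => ?_) (fun h0 => ?_)
    fun h0 i hi => ?_)))
  · obtain ⟨i, hi⟩ := I.letters a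
    exact key [a] ⟨i, hi⟩ (by rw [h0, List.append_nil])
  · obtain ⟨i, hi⟩ := I.dropLast_mem hyY h0
    exact ⟨i, by rwa [hY]⟩
  · rw [hY] at hi
    obtain ⟨w, hw⟩ := I.dom_left i _ (I.done_of_lt i _ hi (by omega)) hdlen a
    have hnone : extendOwner c m0 (.phi i [a] y.dropLast) = none :=
      if_neg fun h1 => absurd h1.2 (not_le.2 hdlen)
    obtain ⟨h1, h2⟩ := I.phi_val _ _ _ _ hw
    exact ⟨.inl hnone, w, (h.unowned _ hnone).trans hw, key w h1 h2⟩

/-- The words whose left multiples are determined in the third phase. -/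
def leftTargets (c : ℕ) (m : Mem r k) (j : Fin k) : List (Word r) :=
  (doneWords m j).drop ((m (.Y j)).countP fun y => decide (y.length < c))

theorem mem_leftTargets (hs : (m (.Y j)).Pairwise slt) {w : Word r} :
    w ∈ leftTargets c m j ↔ w ∈ doneWords m j ∧ c ≤ w.length := by
  unfold leftTargets
  set L := (m (.Y j)).countP fun y => decide (y.length < c) with hL
  have hmem {w} : w ∈ (m (.Y j)).take L ↔ w ∈ m (.Y j) ∧ w.length < c :=
    mem_take_countP_length_lt hs
  constructor
  · intro hw
    have hwd := List.mem_of_mem_drop hw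
    refine ⟨hwd, ?_⟩
    by_contra hwc
    have h1 := hmem.2 ⟨mem_of_mem_doneWords hwd, not_le.1 hwc⟩
    have hs' := hs
    rw [← List.take_append_drop L (m (.Y j)), List.pairwise_append] at hs'
    -- The word would lie on both sides of the cut of `Y_j` at `L`.
    refine slt_irrefl w (hs'.2.2 w h1 w ?_)
    rw [doneWords, List.drop_take] at hw
    exact List.mem_of_mem_take hw
  · rintro ⟨hw, hwc⟩
    rw [← List.take_append_drop L (doneWords m j), List.mem_append] at hw
    refine hw.resolve_left fun h1 => ?_
    rw [doneWords, List.take_take, min_comm, ← List.take_take] at h1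
    exact absurd (hmem.1 (List.mem_of_mem_take h1)).2 (not_lt.2 hwc)

theorem wp_extendLeft (I : Inv gen m0 (c + 1) (c + 1) c) :
    wp (extendOwner c m0) j (extendLeft c j) m0 fun _ =>
      Extended gen c j m0 fun v _ => v ∈ leftTargets c m0 j := by
  unfold extendLeft
  refine wp_bind (wp_getY (.inl rfl) (wp_bind (wp_getK (.inl rfl) ?_)))
  change wp _ _ (forEach _ (leftTargets c m0 j)) _ _
  refine wp_forEach (fun pre m => Extended gen c j m0 (fun v _ => v ∈ pre) m)
    ⟨fun _ _ => rfl, by simp, fun u v x hx => ⟨x, hx⟩, I.phi_val j, fun u v x hx => .inl hx⟩ ?_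
  intro pre y post hxs m h
  have hy : y ∈ leftTargets c m0 j := by simp [hxs]
  obtain ⟨hyd, hyc⟩ := (mem_leftTargets (I.sorted j)).1 hy
  refine wp_mono (wp_forEach (fun apre m => Extended gen c j m0
    (fun v a => v ∈ pre ∨ v = y ∧ a ∈ apre) m) ?_ ?_) ?_
  · simpa using h
  · rintro apre a apost - m h
    refine wp_extendLeft_step I hyd hyc h fun v a' => ?_
    simp only [List.mem_append, List.mem_singleton]
    tauto
  · intro _ m' h'
    simpa [List.mem_append] using h'

theorem inv_of_extended (I : Inv gen m0 (c + 1) (c + 1) c)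
    (h : ∀ j, Extended gen c j m0 (fun v _ => v ∈ leftTargets c m0 j) m) :
    Inv gen m (c + 1) (c + 1) (c + 1) ∧ Ext m0 m := by
  have hY (i) : m (.Y i) = m0 (.Y i) := (h i).unowned _ rfl
  have hK (i) : m (.K i) = m0 (.K i) := (h i).unowned _ rfl
  have hD (i) : doneWords m i = doneWords m0 i := by rw [doneWords, hY, hK, doneWords]
  have hmem (i) {w} : w ∈ leftTargets c m0 i ↔ w ∈ doneWords m0 i ∧ c ≤ w.length :=
    mem_leftTargets (I.sorted i)
  refine ⟨⟨⟨by simpa only [hY] using I.sorted, by simpa only [hY] using I.disjoint,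
    by simpa only [hY] using I.reduced, by simpa only [hY] using I.letters,
    by simpa only [hY] using I.initial, by simpa only [hK] using I.one_le,
    by simpa only [hY, hK] using I.le, by simpa only [hY, hD] using I.done_of_lt,
    by simpa only [hD] using I.lt_of_done, fun i => by simpa only [hY] using (h i).phi_val,
    fun i v hv _ a => ?_, fun i u v x hx => ?_⟩, fun i u hu a => ?_⟩,
    fun i => (hK i).ge, fun i => by rw [hY]; exact fun y hy => hy,
    fun i => by rw [hD]; exact fun y hy => hy, fun i => (h i).mono⟩
  · rw [hD] at hv
    by_cases hvc : v.length < c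
    · obtain ⟨x, hx⟩ := I.dom_left i v hv hvc a
      exact (h i).mono _ _ _ hx
    · exact (h i).defined v a ((hmem i).2 ⟨hv, not_lt.1 hvc⟩)
  · rw [hD]
    rcases (h i).dom_only u v x hx with h1 | ⟨a, rfl, h1⟩
    · exact I.dom_only i u v x h1
    · exact .inl ⟨⟨a, rfl⟩, ((hmem i).1 h1).1⟩
  · rw [hD] at hu
    obtain ⟨x, hx⟩ := I.dom_right i u hu a
    exact (h i).mono _ _ _ hx

end Extend

/-! ### Snapshots, fragments and the invariant -/

section Conversion

variable {U : Type*} [Semigroup U] {r k : ℕ} {gen : Fin r → U} {m m' : Mem r k} {c p q l : ℕ}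
  {F : Fin k → Fragment r} {T T' : Snapshot r}

/-- The done words of the snapshot are an initial part of `Y`, so every word shorter than some done
word is done. This puts all words shorter than the initial `c` among the done ones, while words of
length exactly `c` may be on either side. -/
theorem inv_initialMem (hT : IsSnapshot gen T) (hF : IsUnion F T) :
    Inv gen (initialMem F) (max (level F) 1) (max (level F) 1 + 1) (max (level F) 1) := by
  have hmem {j w} (hw : w ∈ (F j).Y) : w ∈ T.Y := (hF.mem w).2 ⟨j, hw⟩
  have hdone {j w} (hw : w ∈ (F j).Y.take ((F j).K - 1)) : w ∈ T.Y.take (T.K - 1) :=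
    (hF.done j w (List.mem_of_mem_take hw)).1 hw
  have hlevel {j : Fin k} {w : Word r} (hw : w ∈ (F j).Y)
      (hwl : w.length < max (level F) 1) :
      ∃ z ∈ T.Y.take (T.K - 1), w.length < z.length := by
    have hpos := List.length_pos_iff.2 (hT.reduced w (hmem hw)).1
    -- Reduced words are non-empty, so the alternative `1` in the maximum is irrelevant.
    have hlt : w.length < level F := by omega
    obtain ⟨i, -, hi⟩ := Finset.lt_sup_iff.1 hlt
    cases hz : lastDone (F i).Y (F i).K with
    | none => simp [hz] at hi
    | some z => exact ⟨z, hdone (lastDone_mem hz), by simpa [hz] using hi⟩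
  refine ⟨⟨hF.sorted, fun i j w hi hj => ?_, fun j y hy => hT.reduced y (hmem hy),
    fun a => (hF.mem _).1 (hT.letters a), fun x hx => ?_, hF.one_le, hF.le,
    fun j w hw hwl => ?_, fun j w hw => ?_, fun j u v x hx => ?_, fun j v hv hvl a => ?_,
    fun j u v x hx => ?_⟩, fun j u hu a => ?_⟩
  · by_contra hij
    exact hF.disjoint i j hij w hi hj
  · exact (hT.initial x hx).imp (hF.mem x).1 fun h j y hy => h y (hmem hy)
  · obtain ⟨z, hz, hwz⟩ := hlevel hw hwl
    exact (hF.done j w hw).2 (mem_take_of_slt hT.sorted hz (hmem hw) (slt_of_length_lt hwz))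
  · obtain ⟨z, hz, hwz⟩ := exists_lastDone (K := (F j).K) (hF.sorted j) hw
    have h1 : w.length ≤ z.length := by
      rcases hwz with rfl | hwz
      · exact le_rfl
      · exact length_le_of_slt hwz
    have h2 := Finset.le_sup (f := fun i => ((lastDone (F i).Y (F i).K).map List.length).getD 0)
      (Finset.mem_univ j)
    change _ ≤ level F at h2
    simp only [hz, Option.map_some, Option.getD_some] at h2
    omega
  · obtain ⟨h1, h2⟩ := hT.phi_val u v x ((hF.phi u v x).2 ⟨j, hx⟩)
    exact ⟨(hF.mem x).1 h1, h2⟩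
  · obtain ⟨L, hL, hdom⟩ := hF.dom
    have hvY := mem_of_mem_doneWords hv
    refine Option.isSome_iff_exists.1 ((hdom j [a] v).2 (.inl ⟨⟨a, rfl⟩, hvY, ?_⟩))
    -- If `L < K - 1`, left multiples are stored only for words shorter than `y_{K-1}`; a word
    -- shorter than `c` is shorter than some done word, hence than `y_{K-1}`.
    rcases hL with rfl | ⟨-, z, hz, rfl⟩
    · exact hdone hv
    · rw [mem_take_countP_length_lt hT.sorted]
      obtain ⟨z', hz', hvz'⟩ := hlevel hvY hvl
      refine ⟨hmem hvY, hvz'.trans_le ?_⟩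
      rcases lastDone_spec hT.sorted hz hz' with rfl | h
      · exact le_rfl
      · exact length_le_of_slt h
  · obtain ⟨L, hL, hdom⟩ := hF.dom
    refine ((hdom j u v).1 (Option.isSome_iff_exists.2 ⟨x, hx⟩)).imp_left ?_
    rintro ⟨h1, h2, h3⟩
    refine ⟨h1, (hF.done j v h2).2 (List.take_subset_take_left _ ?_ h3)⟩
    rcases hL with rfl | ⟨h, -⟩
    · exact le_rfl
    · exact h.le
  · obtain ⟨L, hL, hdom⟩ := hF.dom
    exact Option.isSome_iff_exists.1 ((hdom j u [a]).2 (.inr ⟨hu, a, rfl⟩))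

/-- Stored values are not changed, as there is only one reduced word with a given value. -/
theorem Inv.phi_eq (I : Inv gen m p q l) {p' q' l' : ℕ} (I' : Inv gen m' p' q' l')
    (h : Ext m m') {j : Fin k} {u v x : Word r} (hx : m (.phi j u v) = some x) :
    m' (.phi j u v) = some x := by
  obtain ⟨x', hx'⟩ := h.phi j u v x hx
  obtain ⟨⟨i, hi⟩, h1⟩ := I.phi_val j u v x hx
  obtain ⟨h2, h3⟩ := I'.phi_val j u v x' hx'
  rw [hx', I'.eq_of_val_eq (I.reduced i x hi) h2 (h1.trans h3.symm)]

theorem Inv.doneWords_iff (I : Inv gen m c c c) {j : Fin k} {w : Word r} :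
    w ∈ doneWords m j ↔ w ∈ m (.Y j) ∧ w.length < c :=
  ⟨fun h => ⟨mem_of_mem_doneWords h, I.lt_of_done j w h⟩, fun h => I.done_of_lt j w h.1 h.2⟩

theorem Inv.isSome_iff (I : Inv gen m c c c) {j : Fin k} {u v : Word r} :
    (m (.phi j u v)).isSome ↔
      (IsLetter u ∧ v ∈ doneWords m j) ∨ (u ∈ doneWords m j ∧ IsLetter v) := by
  rw [Option.isSome_iff_exists]
  constructor
  · rintro ⟨x, hx⟩
    exact I.dom_only j u v x hx
  · rintro (⟨⟨a, rfl⟩, hv⟩ | ⟨hu, a, rfl⟩)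
    · exact I.dom_left j v hv (I.lt_of_done j v hv) a
    · exact I.dom_right j u hu a

theorem Inv.goodCollection (I : Inv gen m c c c) (hc : 1 ≤ c) :
    GoodCollection gen (fragments m) where
  fragment j :=
    { sorted := I.sorted j
      reduced := I.reduced j
      one_le := I.one_le j
      le := I.le j
      last := fun z hz y hy hyz => lastDone_spec (I.sorted j) hz
        (I.doneWords_iff.2 ⟨hy, hyz ▸ I.lt_of_done j z (lastDone_mem hz)⟩)
      phi_val := fun u v x hx => by
        obtain ⟨⟨i, hi⟩, h⟩ := I.phi_val j u v x hx
        exact ⟨I.reduced i x hi, h⟩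
      phi_dom := ⟨_, .inl rfl, fun u v => I.isSome_iff⟩ }
  letters := I.letters
  disjoint i j hij y hi hj := hij (I.disjoint i j y hi hj)
  initial := I.initial
  level j y hy hyl := by
    have h1 : level (fragments m) < c := by
      -- The bound `1 ≤ c` is needed for the default level `0`, attained when nothing is done.
      refine (Finset.sup_lt_iff (by exact hc)).2 fun i _ => ?_
      cases hz : lastDone (fragments m i).Y (fragments m i).K with
      | none => exact hc
      | some z => exact I.lt_of_done i z (lastDone_mem hz)
    obtain ⟨z, hz, hyz⟩ := exists_lastDone (I.sorted j)
      (I.doneWords_iff.2 ⟨hy, hyl.trans_lt h1⟩ : y ∈ doneWords m j)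
    refine ⟨z, hz, ?_⟩
    rcases hyz with rfl | hyz
    · exact le_rfl
    · exact length_le_of_slt hyz
  dom j u v := I.isSome_iff
  im j u v x hx := (I.phi_val j u v x hx).1

open Classical in
-- The comparison used for sorting is only a weak order; strictness comes from the absence of
-- duplicates.
theorem exists_sorted_list (s : Finset (Word r)) :
    ∃ Y : List (Word r), Y.Pairwise slt ∧ ∀ w, w ∈ Y ↔ w ∈ s := by
  refine ⟨s.toList.mergeSort fun u v => decide (¬ slt v u), ?_, by simp⟩
  have h1 := List.pairwise_mergeSort (le := fun u v : Word r => decide (¬ slt v u))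
    (fun u v w h h' => ?_) (fun u v => ?_) s.toList
  · have h2 : (s.toList.mergeSort fun u v => decide (¬ slt v u)).Pairwise (· ≠ ·) :=
      (List.mergeSort_perm _ _).nodup_iff.2 s.nodup_toList
    refine (h1.and h2).imp fun {u v} h => ?_
    rcases slt_trichotomy u v with h3 | h3 | h3
    · exact h3
    · exact absurd h3 h.2
    · exact absurd h3 (by simpa using h.1)
  · simp only [decide_eq_true_eq] at *
    intro h2
    rcases slt_trichotomy v u with h3 | h3 | h3
    · exact h h3
    · exact h' (h3 ▸ h2)
    · exact h' (slt_trans h2 h3)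
  · simp only [Bool.or_eq_true, decide_eq_true_eq, ← not_and_or]
    exact fun h => slt_asymm h.1 h.2

open Classical in
-- With equal thresholds the done words are those shorter than `c`, an initial part of the merged
-- list; so `K - 1` is their number, and `L = K - 1`.
theorem Inv.exists_snapshot (I : Inv gen m c c c) :
    ∃ T : Snapshot r, IsSnapshot gen T ∧ T.B = ∅ ∧ IsUnion (fragments m) T := by
  obtain ⟨Y, hY, hmem⟩ := exists_sorted_list (Finset.univ.biUnion fun j => (m (.Y j)).toFinset)
  replace hmem (w) : w ∈ Y ↔ ∃ j, w ∈ m (.Y j) := by simp [hmem]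
  have htake (w : Word r) : w ∈ Y.take (Y.countP (fun y => decide (y.length < c)) + 1 - 1) ↔
      w ∈ Y ∧ w.length < c := mem_take_countP_length_lt hY
  have hdone (w : Word r) : w ∈ Y.take (Y.countP (fun y => decide (y.length < c)) + 1 - 1) ↔
      ∃ j, w ∈ doneWords m j := by
    simp only [htake, I.doneWords_iff, hmem]
    exact ⟨fun ⟨⟨j, h⟩, h'⟩ => ⟨j, h, h'⟩, fun ⟨j, h, h'⟩ => ⟨⟨j, h⟩, h'⟩⟩
  -- Two tuples may both store a product of two letters. The choice does not matter: both values are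
  -- reduced words with the same value under `ν`.
  let phi : Word r → Word r → Option (Word r) := fun u v =>
    if h : ∃ x, ∃ j, m (.phi j u v) = some x then some h.choose else none
  have hphi (u v x) : phi u v = some x ↔ ∃ j, m (.phi j u v) = some x := by
    constructor
    · intro h
      by_cases h' : ∃ x, ∃ j, m (.phi j u v) = some x
      · rw [← Option.some_inj.1 ((dif_pos h').symm.trans h)]
        exact h'.choose_spec
      · exact absurd ((dif_neg h').symm.trans h) (by simp)
    · rintro ⟨j, hj⟩
      have h' : ∃ x, ∃ j, m (.phi j u v) = some x := ⟨x, j, hj⟩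
      refine (dif_pos h').trans ?_
      obtain ⟨j', hj'⟩ := h'.choose_spec
      obtain ⟨⟨i, hi⟩, h1⟩ := I.phi_val j u v x hj
      obtain ⟨h2, h3⟩ := I.phi_val _ _ _ _ hj'
      rw [I.eq_of_val_eq (I.reduced i x hi) h2 (h1.trans h3.symm)]
  refine ⟨⟨Y, Y.countP (fun y => decide (y.length < c)) + 1, ∅, phi⟩,
    ⟨hY, fun a => (hmem _).2 (I.letters a), fun y hy => ?_, fun x hx => ?_, Nat.le_add_left .., ?_,
      by simp, fun u v x hx => ?_, _, .inl rfl, fun u v => ?_⟩, rfl,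
    ⟨I.sorted, fun i j hij y hi hj => hij (I.disjoint i j y hi hj), hmem, I.one_le, I.le,
      fun j w hw => ?_, hphi, _, .inl rfl, fun j u v => ?_⟩⟩
  · obtain ⟨j, hj⟩ := (hmem y).1 hy
    exact I.reduced j y hj
  · refine (I.initial x hx).imp (hmem x).2 fun h y hy => ?_
    obtain ⟨j, hj⟩ := (hmem y).1 hy
    exact h j y hj
  · exact Nat.succ_le_succ List.countP_le_length
  · obtain ⟨j, hj⟩ := (hphi u v x).1 hx
    rw [hmem]
    exact I.phi_val j u v x hj
  · have h1 : (phi u v).isSome ↔ ∃ j, (m (.phi j u v)).isSome := by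
      simp only [Option.isSome_iff_exists, hphi]
      exact exists_comm
    simp only [h1, I.isSome_iff, hdone, exists_or, exists_and_left, exists_and_right]
    simp
  · rw [htake, hmem]
    exact I.doneWords_iff.trans ⟨fun h => ⟨⟨j, h.1⟩, h.2⟩, fun h => ⟨hw, h.2⟩⟩
  · refine I.isSome_iff.trans (or_congr_left (and_congr_right fun _ => ?_))
    rw [htake, I.doneWords_iff, hmem]
    exact ⟨fun h => ⟨h.1, ⟨j, h.1⟩, h.2⟩, fun h => ⟨h.1, h.2.2⟩⟩

theorem fragment_extendsTo (I : Inv gen (initialMem F) p q l) {p' q' l' : ℕ}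
    (I' : Inv gen m p' q' l') (h : Ext (initialMem F) m) (j : Fin k) :
    (F j).ExtendsTo (fragments m j) :=
  ⟨h.K j, h.Y j, fun _ _ _ hx => I.phi_eq I' h hx⟩

theorem snapshot_extendsTo (hT : IsSnapshot gen T) (hF : IsUnion F T)
    (hT' : IsSnapshot gen T') (hF' : IsUnion (fragments m) T') (h : Ext (initialMem F) m) :
    T.ExtendsTo T' := by
  have hY {y} (hy : y ∈ T.Y) : y ∈ T'.Y := by
    obtain ⟨j, hj⟩ := (hF.mem y).1 hy
    exact (hF'.mem y).2 ⟨j, h.Y j y hj⟩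
  refine ⟨?_, fun y => hY, fun u v x hx => ?_⟩
  -- Done words stay done, so the comparison of `K` and `K'` becomes one of the numbers of done
  -- words.
  · have h1 : (T.Y.take (T.K - 1)).length ≤ (T'.Y.take (T'.K - 1)).length := by
      refine ((nodup_of_sorted hT.sorted).sublist (List.take_sublist _ _)).length_le_of_subset
        fun y hy => ?_
      obtain ⟨j, hj⟩ := (hF.mem y).1 (List.mem_of_mem_take hy)
      exact (hF'.done j y (h.Y j y hj)).1 (h.done j y ((hF.done j y hj).2 hy))
    have h2 := hT.one_le
    have h3 := hT.le
    have h4 := hT'.one_le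
    rw [List.length_take, List.length_take] at h1
    omega
  · obtain ⟨j, hj⟩ := (hF.phi u v x).1 hx
    obtain ⟨x', hx'⟩ := h.phi j u v x hj
    have h1 := (hF'.phi u v x').2 ⟨j, hx'⟩
    obtain ⟨h2, h3⟩ := hT.phi_val u v x hx
    obtain ⟨h4, h5⟩ := hT'.phi_val u v x' h1
    rw [h1, (hT.reduced x h2).eq_of_val_eq (hT'.reduced x' h4) (h3.trans h5.symm)]

/-- If everything is done, the values of the known words contain the generators and are closed under
right multiplication by generators, so they exhaust `S`. -/
theorem Inv.cardS_le (I : Inv gen m p q l) (h : ∀ j, doneWords m j = m (.Y j))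
    {Y : List (Word r)} (hY : ∀ j, ∀ w ∈ m (.Y j), w ∈ Y) : cardS gen ≤ (Y.length : ℕ∞) := by
  have hw : ∀ w : Word r, w ≠ [] → ∃ y ∈ Y, val gen y = val gen w := by
    suffices H : ∀ w : Word r, w ≠ [] → ∃ j, ∃ y ∈ m (.Y j), val gen y = val gen w by
      intro w hw
      obtain ⟨j, y, hy, hval⟩ := H w hw
      exact ⟨y, hY j y hy, hval⟩
    intro w
    induction w using List.reverseRecOn with
    | nil => exact fun h => absurd rfl h
    | append_singleton w a ih =>
      intro _
      by_cases hw : w = []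
      · obtain ⟨j, hj⟩ := I.letters a
        exact ⟨j, [a], hj, by rw [hw, List.nil_append]⟩
      · obtain ⟨j, y, hy, hval⟩ := ih hw
        rw [← h] at hy
        obtain ⟨x, hx⟩ := I.dom_right j y hy a
        obtain ⟨⟨i, hi⟩, h1⟩ := I.phi_val _ _ _ _ hx
        exact ⟨i, x, hi, by rw [h1, val_append, hval, val_append]⟩
  have hinj : Function.Injective ((↑) : U → WithOne U) := fun _ _ h => WithOne.coe_inj.1 h
  have hsub : ((↑) : U → WithOne U) '' (Subsemigroup.closure (Set.range gen) : Set U) ⊆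
      val gen '' {y | y ∈ Y} := by
    rintro _ ⟨s, hs, rfl⟩
    obtain ⟨w, hw0, hws⟩ := exists_val_eq_of_mem_closure hs
    obtain ⟨y, hy, hyw⟩ := hw w hw0
    exact ⟨y, hy, hyw.trans hws⟩
  have hY' : {y | y ∈ Y} = (Y.toFinset : Set (Word r)) := by
    ext
    simp
  calc cardS gen = (((↑) : U → WithOne U) ''
        (Subsemigroup.closure (Set.range gen) : Set U)).encard := (hinj.encard_image _).symm
    _ ≤ (val gen '' {y | y ∈ Y}).encard := Set.encard_le_encard hsub
    _ ≤ {y | y ∈ Y}.encard := Set.encard_image_le _ _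
    _ = (Y.toFinset.card : ℕ∞) := by rw [hY', Set.encard_coe_eq_coe_finsetCard]
    _ ≤ (Y.length : ℕ∞) := by exact_mod_cast Y.toFinset_card_le

theorem Inv.min_le (I : Inv gen m p q l) {M : ℕ} (h : ¬ LoopCondition M m)
    (hT : IsUnion (fragments m) T) : min (M : ℕ∞) (cardS gen) ≤ (T.Y.length : ℕ∞) := by
  rcases not_and_or.1 h with h | h
  · push Not at h
    refine (min_le_right _ _).trans (I.cardS_le (fun j => ?_) fun j w hw => (hT.mem w).2 ⟨j, hw⟩)
    exact List.take_of_length_le (Nat.le_sub_one_of_lt (h j))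
  · refine (min_le_left _ _).trans ?_
    have h1 : (Finset.univ.biUnion fun j => (fragments m j).Y.toFinset) ⊆ T.Y.toFinset := by
      intro w hw
      simp only [Finset.mem_biUnion, Finset.mem_univ, true_and, List.mem_toFinset] at hw ⊢
      exact (hT.mem w).2 hw
    exact_mod_cast (not_lt.1 h).trans ((Finset.card_le_card h1).trans T.Y.toFinset_card_le)

/-- An unfinished word has length at least `c`. Its prefixes of lengths `1, ..., c` are distinct
reduced words of the union, which has fewer than `M` members. -/
theorem Inv.lt_of_loopCondition (I : Inv gen m c q l) {M : ℕ} (h : LoopCondition M m) :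
    c < M := by
  obtain ⟨⟨j, hj⟩, h⟩ := h
  refine lt_of_le_of_lt ?_ h
  have hlt : m (.K j) - 1 < (m (.Y j)).length :=
    lt_of_lt_of_le (Nat.sub_lt (I.one_le j) Nat.one_pos) hj
  obtain ⟨y, hy⟩ : ∃ y, y ∈ (m (.Y j)).drop (m (.K j) - 1) := by
    refine List.exists_mem_of_length_pos ?_
    rw [List.length_drop]
    exact Nat.sub_pos_of_lt hlt
  have hyY := List.mem_of_mem_drop hy
  have hyc : c ≤ y.length := by
    by_contra hyc
    have hs := I.sorted j
    rw [← List.take_append_drop (m (.K j) - 1) (m (.Y j)), List.pairwise_append] at hs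
    exact slt_irrefl y (hs.2.2 y (I.done_of_lt j y hyY (not_le.1 hyc)) y hy)
  have hcard : (Finset.Icc 1 c).card ≤
      (Finset.univ.biUnion fun j => (fragments m j).Y.toFinset).card := by
    refine Finset.card_le_card_of_injOn (fun i => y.take i) (fun i hi => ?_)
      fun i hi i' hi' hii' => ?_
    · simp only [Finset.coe_Icc, Set.mem_Icc] at hi
      simp only [Finset.mem_coe, Finset.mem_biUnion, Finset.mem_univ, true_and, List.mem_toFinset]
      have hlen : (y.take i).length = i := by
        rw [List.length_take]
        omega
      have hred : Reduced gen (y.take i) := by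
        refine Reduced.of_append (w := y.drop i) ?_ (List.length_pos_iff.1 (by omega))
        rw [List.take_append_drop]
        exact I.reduced j y hyY
      rcases (hi.2.trans hyc).lt_or_eq with h1 | h1
      · exact I.mem_of_slt hred hyY (slt_of_length_lt (by omega))
      · rw [h1, List.take_length]
        exact ⟨j, hyY⟩
    · simp only [Finset.coe_Icc, Set.mem_Icc] at hi hi'
      have h1 := congrArg List.length hii'
      simp only [List.length_take] at h1
      omega
  simpa using hcard

/-- Filtering turns an initial part into an initial part; so the words assigned to one process have
the done ones in front. -/
theorem take_countP_filter {α : Type*} (p : α → Bool) (Y : List α) (n : ℕ) :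
    (Y.filter p).take ((Y.take n).countP p) = (Y.take n).filter p := by
  conv_lhs => rw [← List.take_append_drop n Y, List.filter_append]
  rw [List.countP_eq_length_filter, List.take_append_of_le_length (by simp), List.take_of_length_le]
  simp

open Classical in
/-- Every distribution of the words of a snapshot is realized by a collection of tuples. -/
theorem exists_isUnion (hT : IsSnapshot gen T) (hB : T.B = ∅) (β : Word r → Fin k) :
    ∃ F : Fin k → Fragment r, IsUnion F T ∧ ∀ j w, w ∈ (F j).Y ↔ w ∈ T.Y ∧ β w = j := by
  obtain ⟨L, hL, hdom⟩ := hT.phi_dom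
  have hLK : L ≤ T.K - 1 := by
    rcases hL with rfl | ⟨h, -⟩
    · exact le_rfl
    · exact h.le
  let Y (j : Fin k) := T.Y.filter fun w => decide (β w = j)
  let K (j : Fin k) := (T.Y.take (T.K - 1)).countP (fun w => decide (β w = j)) + 1
  have hmem (j w) : w ∈ Y j ↔ w ∈ T.Y ∧ β w = j := by simp [Y]
  have htake (j w) : w ∈ (Y j).take (K j - 1) ↔ w ∈ T.Y.take (T.K - 1) ∧ β w = j := by
    simp only [Y, K, Nat.add_sub_cancel, take_countP_filter]
    simp
  let D (j : Fin k) (u v : Word r) : Prop :=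
    (IsLetter u ∧ v ∈ Y j ∧ v ∈ T.Y.take L) ∨ (u ∈ (Y j).take (K j - 1) ∧ IsLetter v)
  have hD (u v) : (T.phi u v).isSome ↔ ∃ j, D j u v := by
    simp only [hdom, hB, D, htake, hmem]
    constructor
    · rintro (⟨h1, h2⟩ | ⟨h1, h2⟩ | ⟨-, a, ha, -⟩)
      · exact ⟨β v, .inl ⟨h1, ⟨List.mem_of_mem_take h2, rfl⟩, h2⟩⟩
      · exact ⟨β u, .inr ⟨⟨h1, rfl⟩, h2⟩⟩
      · simp at ha
    · rintro ⟨j, ⟨h1, -, h2⟩ | ⟨⟨h1, -⟩, h2⟩⟩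
      · exact .inl ⟨h1, h2⟩
      · exact .inr (.inl ⟨h1, h2⟩)
  refine ⟨fun j => ⟨Y j, K j, fun u v => if D j u v then T.phi u v else none⟩,
    ⟨fun j => hT.sorted.filter _, fun i j hij y hi hj => ?_, fun w => ?_,
      fun j => Nat.le_add_left _ _, fun j => ?_, fun j w hw => ?_, fun u v x => ?_, L, hL,
      fun j u v => ?_⟩, hmem⟩
  · exact hij (((hmem i y).1 hi).2.symm.trans ((hmem j y).1 hj).2)
  · simp [hmem]
  · simp only [Y, K, ← List.countP_eq_length_filter]
    exact Nat.add_le_add_right ((List.take_sublist _ _).countP_le) 1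
  · rw [htake]
    exact and_iff_left ((hmem j w).1 hw).2
  · constructor
    · intro hx
      obtain ⟨j, hj⟩ := (hD u v).1 (Option.isSome_iff_exists.2 ⟨x, hx⟩)
      exact ⟨j, (if_pos hj).trans hx⟩
    · rintro ⟨j, hj⟩
      dsimp only at hj
      split_ifs at hj
      exact hj
  · dsimp only
    split_ifs with h
    · exact iff_of_true ((hD u v).2 ⟨j, h⟩) h
    · exact iff_of_false (by simp) h

end Conversion

/-! ### Concurrent runs -/

section Concurrency

variable {U : Type*} [Semigroup U] {r k : ℕ} {gen : Fin r → U} {b : WithOne U → Fin k}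
  {M : ℕ} {F : Fin k → Fragment r}

/-- Every process is going to achieve its goal `Q j`, and has so far respected the owners. -/
structure Running (own : Loc r k → Option (Fin k)) (Q : Fin k → Mem r k → Prop)
    (C : Config r k) : Prop where
  wp : ∀ j, wp own j (C.procs j) C.mem fun _ => Q j
  log : ∀ e ∈ C.log, Readable own e.1 e.2.1 ∧ (e.2.2 = true → own e.2.1 = some e.1)

variable {own : Loc r k → Option (Fin k)} {Q : Fin k → Mem r k → Prop} {C : Config r k}

theorem Running.read (h : Running own Q C) {j : Fin k} {l : Loc r k}
    {next : l.Val → Prog r k Unit} (hj : C.procs j = .read l next) :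
    Running own Q ⟨C.mem, C.c, C.phase, Function.update C.procs j (next (C.mem l)),
      (j, l, false) :: C.log⟩ := by
  have h1 := h.wp j
  rw [hj] at h1
  refine ⟨fun i => ?_, fun e he => ?_⟩
  · by_cases hi : i = j
    · subst hi
      simpa using h1.2
    · simpa [hi] using h.wp i
  · rcases List.mem_cons.1 he with rfl | he
    · exact ⟨h1.1, by simp⟩
    · exact h.log e he

/-- The location written is owned by `j`, so no other process may read it, and `wp_congr` applies to
all of them. -/
theorem Running.write (hQ : ∀ j, Stable own j (Q j)) (h : Running own Q C) {j : Fin k}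
    {l : Loc r k} {v : l.Val} {next : Prog r k Unit} (hj : C.procs j = .write l v next) :
    Running own Q ⟨Function.update C.mem l v, C.c, C.phase, Function.update C.procs j next,
      (j, l, true) :: C.log⟩ := by
  have h1 := h.wp j
  rw [hj] at h1
  refine ⟨fun i => ?_, fun e he => ?_⟩
  · by_cases hi : i = j
    · subst hi
      simpa using h1.2
    · have h2 := wp_congr (m' := Function.update C.mem l v) (fun _ => hQ i) (fun l' hl' => ?_)
        (h.wp i)
      · simpa [hi] using h2
      · refine (Function.update_of_ne ?_ _ _).symm
        rintro rfl
        have h3 := h1.1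
        rcases hl' with hl' | hl'
        · simp [hl'] at h3
        · rw [hl'] at h3
          exact hi (Option.some_inj.1 h3)
  · rcases List.mem_cons.1 he with rfl | he
    · exact ⟨.inr h1.1, fun _ => h1.1⟩
    · exact h.log e he

theorem Running.post (h : Running own Q C) (hr : ∀ j, C.procs j = .ret ()) (j : Fin k) :
    Q j C.mem := by
  have h1 := h.wp j
  rw [hr j] at h1
  exact h1

/-- A write reveals the owner of its location, and any access by another process would contradict
that ownership. -/
theorem Running.noConflict (h : Running own Q C) : NoConflict C.log := by
  intro e he e' he' hne hl
  obtain ⟨h1, h2⟩ := h.log e he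
  obtain ⟨h3, h4⟩ := h.log e' he'
  rw [← hl] at h3 h4
  constructor <;> refine Bool.eq_false_iff.2 fun hw => ?_
  · rcases h3 with h3 | h3 <;> rw [h2 hw] at h3
    · cases h3
    · exact hne (Option.some_inj.1 h3)
  · rcases h1 with h1 | h1 <;> rw [h4 hw] at h1
    · cases h1
    · exact hne (Option.some_inj.1 h1).symm

theorem Running.ne_fail (h : Running own Q C) (j : Fin k) : C.procs j ≠ .fail := by
  intro hj
  have h1 := h.wp j
  rw [hj] at h1
  exact h1

theorem exists_step_or_ret (C : Config r k) (h : ∀ j, C.procs j ≠ .fail) :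
    (∃ C', Step gen b M C C') ∨ ∀ j, C.procs j = .ret () := by
  by_contra! hcon
  obtain ⟨hno, j, hj⟩ := hcon
  cases hP : C.procs j with
  | ret x => exact hj hP
  | fail => exact h j hP
  | read l next => exact hno _ (.read C j l next hP)
  | write l v next => exact hno _ (.write C j l v next hP)

/-! ### The invariant of the main loop -/

/-- The state of the memory at the test of the main loop: either no iteration has been
performed, or all words of length less than `c` have been dealt with. -/
structure HeadInv (gen : Fin r → U) (F : Fin k → Fragment r) (m : Mem r k) (c : ℕ) : Prop where
  one_le : 1 ≤ c
  inv : Inv gen m c (c + 1) c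
  ext : Ext (initialMem F) m
  fresh : fragments m = F ∨ Inv gen m c c c

/-- The invariant of the configurations: within a phase that starts in the memory `m0`, every
process is going to attain its goal. -/
def ConfigInv (gen : Fin r → U) (b : WithOne U → Fin k) (M : ℕ) (F : Fin k → Fragment r)
    (C : Config r k) : Prop :=
  match C.phase with
  | .head | .done => (∀ j, C.procs j = .ret ()) ∧ C.log = [] ∧ HeadInv gen F C.mem C.c ∧
      (C.phase = .done → ¬ LoopCondition M C.mem)
  | .apply => C.c < M ∧ 1 ≤ C.c ∧ ∃ m0, Inv gen m0 C.c (C.c + 1) C.c ∧ Ext (initialMem F) m0 ∧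
      Running (applyOwner C.c) (ApplyPost gen b C.c m0) C
  | .process => C.c < M ∧ 1 ≤ C.c ∧ ∃ m0, Queued gen b C.c m0 ∧ Ext (initialMem F) m0 ∧
      Running (processOwner gen b) (fun j => Processed gen b j m0 (queuedWords m0)) C
  | .extend => C.c < M ∧ 1 ≤ C.c ∧ ∃ m0, Inv gen m0 (C.c + 1) (C.c + 1) C.c ∧
      Ext (initialMem F) m0 ∧ Running (extendOwner C.c m0)
        (fun j => Extended gen C.c j m0 fun v _ => v ∈ leftTargets C.c m0 j) C

theorem Ext.clearQueues {m m' : Mem r k} (h : Ext m m') : Ext m (clearQueues m') :=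
  ⟨h.K, h.Y, h.done, h.phi⟩

/-- Reads and writes preserve `Running`; at the end of a phase the goals of all processes together
give the invariant needed by the next one. -/
theorem ConfigInv.step {C C' : Config r k} (h : ConfigInv gen b M F C)
    (hstep : Step gen b M C C') : ConfigInv gen b M F C' := by
  cases hstep with
  | enter hp hc =>
    rw [ConfigInv, hp] at h
    obtain ⟨-, -, h, -⟩ := h
    have I : Inv gen (clearQueues C.mem) C.c (C.c + 1) C.c := h.inv.congr rfl
    exact ⟨h.inv.lt_of_loopCondition hc, h.one_le, clearQueues C.mem, I, h.ext.clearQueues,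
      fun j => wp_applyGenerators I rfl, by simp⟩
  | exit hp hc =>
    rw [ConfigInv, hp] at h
    exact ⟨h.1, rfl, h.2.2.1, fun _ => hc⟩
  | read j l next hj =>
    unfold ConfigInv at h ⊢
    dsimp only
    split at h <;> rename_i hp <;> simp only [hp]
    · simp [h.1 j] at hj
    · simp [h.1 j] at hj
    all_goals
      obtain ⟨h1, h2, m0, h3, h4, h5⟩ := h
      have h6 := h5.read hj
      rw [hp] at h6
      exact ⟨h1, h2, m0, h3, h4, h6⟩
  | write j l v next hj =>
    unfold ConfigInv at h ⊢
    dsimp only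
    split at h <;> rename_i hp <;> simp only [hp]
    · simp [h.1 j] at hj
    · simp [h.1 j] at hj
    · obtain ⟨h1, h2, m0, h3, h4, h5⟩ := h
      have h6 := h5.write (fun j => stable_applyPost) hj
      rw [hp] at h6
      exact ⟨h1, h2, m0, h3, h4, h6⟩
    · obtain ⟨h1, h2, m0, h3, h4, h5⟩ := h
      have h6 := h5.write (fun j => stable_processed) hj
      rw [hp] at h6
      exact ⟨h1, h2, m0, h3, h4, h6⟩
    · obtain ⟨h1, h2, m0, h3, h4, h5⟩ := h
      have h6 := h5.write (fun j => stable_extended) hj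
      rw [hp] at h6
      exact ⟨h1, h2, m0, h3, h4, h6⟩
  | endApply hp hr =>
    rw [ConfigInv, hp] at h
    obtain ⟨h1, h2, m0, h3, h4, h5⟩ := h
    obtain ⟨h6, h7⟩ := queued_of_applyPost h3 (h5.post hr)
    exact ⟨h1, h2, C.mem, h6, h4.trans h7, fun j => wp_processQueues h6, by simp⟩
  | endProcess hp hr =>
    rw [ConfigInv, hp] at h
    obtain ⟨h1, h2, m0, h3, h4, h5⟩ := h
    obtain ⟨h6, h7⟩ := inv_of_processed h3 (h5.post hr)
    exact ⟨h1, h2, C.mem, h6, h4.trans h7, fun j => wp_extendLeft h6, by simp⟩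
  | endExtend hp hr =>
    rw [ConfigInv, hp] at h
    obtain ⟨h1, h2, m0, h3, h4, h5⟩ := h
    obtain ⟨h6, h7⟩ := inv_of_extended h3 (h5.post hr)
    -- At the next test `c` has grown by one; the sharp bound is kept in the last component, and
    -- only its weakening is needed to continue.
    exact ⟨hr, rfl, ⟨Nat.le_add_left 1 _, h6.weaken (Nat.le_succ _), h4.trans h7, .inr h6⟩,
      by simp⟩

theorem ConfigInv.noConflict {C : Config r k} (h : ConfigInv gen b M F C) :
    NoConflict C.log := by
  unfold ConfigInv at h
  split at h
  · simp [h.2.1, NoConflict]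
  · simp [h.2.1, NoConflict]
  all_goals
    obtain ⟨-, -, m0, -, -, h⟩ := h
    exact h.noConflict

theorem ConfigInv.ne_fail {C : Config r k} (h : ConfigInv gen b M F C) (j : Fin k) :
    C.procs j ≠ .fail := by
  unfold ConfigInv at h
  split at h
  · simp [h.1 j]
  · simp [h.1 j]
  all_goals
    obtain ⟨-, -, m0, -, -, h⟩ := h
    exact h.ne_fail j

theorem ConfigInv.exists_step {C : Config r k} (h : ConfigInv gen b M F C)
    (hC : C.phase ≠ .done) : ∃ C', Step gen b M C C' := by
  rcases exists_step_or_ret (gen := gen) (b := b) (M := M) C h.ne_fail with h1 | hr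
  · exact h1
  · cases hp : C.phase with
    | head =>
      by_cases hc : LoopCondition M C.mem
      · exact ⟨_, .enter C hp hc⟩
      · exact ⟨_, .exit C hp hc⟩
    | apply => exact ⟨_, .endApply C hp hr⟩
    | process => exact ⟨_, Step.endProcess C hp hr⟩
    | extend => exact ⟨_, .endExtend C hp hr⟩
    | done => exact absurd hp hC

/-! ### Termination -/

/-- `P` is what remains of the second program after its first step. -/
inductive Prog.Next {α : Type} : Prog r k α → Prog r k α → Prop where
  | read (l : Loc r k) (next : l.Val → Prog r k α) (x : l.Val) : Next (next x) (.read l next)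
  | write (l : Loc r k) (v : l.Val) (next : Prog r k α) : Next next (.write l v next)

/-- A program is a well-founded tree, possibly with infinite branching at reads, and a step passes
to a subtree. -/
theorem Prog.wellFounded_next {α : Type} : WellFounded (Prog.Next (r := r) (k := k) (α := α)) := by
  refine ⟨fun P => ?_⟩
  induction P with
  | ret x => exact ⟨_, fun P h => by cases h⟩
  | fail => exact ⟨_, fun P h => by cases h⟩
  | read l next ih => exact ⟨_, fun P h => by cases h with | read _ _ x => exact ih x⟩
  | write l v next ih => exact ⟨_, fun P h => by cases h with | write => exact ih⟩

/-- The number of phases remaining in an iteration. -/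
def Phase.rank : Phase → ℕ
  | .head => 4
  | .apply => 3
  | .process => 2
  | .extend => 1
  | .done => 0

/-- The order in which configurations decrease. -/
def Decreases (M : ℕ) : Config r k → Config r k → Prop :=
  InvImage (Prod.Lex (· < ·) (Pi.Lex (· < ·) fun {_} => Prog.Next))
    fun C => (5 * (M - C.c) + C.phase.rank, C.procs)

/-- There are finitely many processes, so the lexicographic order on families of programs is
well-founded. -/
theorem wellFounded_decreases (M : ℕ) : WellFounded (Decreases (r := r) (k := k) M) :=
  InvImage.wf _ (WellFounded.prod_lex wellFounded_lt
    (Pi.Lex.wellFounded (· < ·) fun _ => Prog.wellFounded_next))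

theorem ConfigInv.decreases {C C' : Config r k} (h : ConfigInv gen b M F C)
    (hstep : Step gen b M C C') : Decreases M C' C := by
  have hupdate : ∀ (j : Fin k) (P : Prog r k Unit), Prog.Next P (C.procs j) →
      Pi.Lex (· < ·) (fun {_} => Prog.Next) (Function.update C.procs j P) C.procs := by
    intro j P hP
    exact ⟨j, fun i hi => Function.update_of_ne hi.ne _ _, by simpa using hP⟩
  cases hstep with
  | enter hp hc =>
    refine Prod.Lex.left _ _ ?_
    simp [hp, Phase.rank]
  | exit hp hc =>
    refine Prod.Lex.left _ _ ?_
    simp [hp, Phase.rank]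
  | read j l next hj => exact Prod.Lex.right _ (hupdate j _ (hj ▸ .read l next _))
  | write j l v next hj => exact Prod.Lex.right _ (hupdate j _ (hj ▸ .write l v next))
  | endApply hp hr =>
    refine Prod.Lex.left _ _ ?_
    simp [hp, Phase.rank]
  | endProcess hp hr =>
    refine Prod.Lex.left _ _ ?_
    simp [hp, Phase.rank]
  | endExtend hp hr =>
    rw [ConfigInv, hp] at h
    -- Since `c < M`, the term `5 * (M - c)` drops by `5`, which outweighs the rise of the rank from
    -- `1` to `4`.
    have h1 := h.1
    refine Prod.Lex.left _ _ ?_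
    simp only [hp, Phase.rank]
    omega

theorem ConfigInv.acc {C : Config r k} (h : ConfigInv gen b M F C) :
    Acc (fun C' C => Step gen b M C C') C := by
  induction C using (wellFounded_decreases (r := r) (k := k) M).induction with
  | _ C ih => exact ⟨_, fun C' hC' => ih C' (h.decreases hC') (h.step hC')⟩

theorem ConfigInv.reachable {C C' : Config r k} (h : ConfigInv gen b M F C)
    (hr : Relation.ReflTransGen (Step gen b M) C C') : ConfigInv gen b M F C' := by
  induction hr with
  | refl => exact h
  | tail _ hstep ih => exact ih.step hstep

theorem configInv_start {T : Snapshot r} (hT : IsSnapshot gen T) (hF : IsUnion F T) :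
    ConfigInv gen b M F (start F) :=
  ⟨fun _ => rfl, rfl, ⟨le_max_right _ _, inv_initialMem hT hF,
    ⟨fun _ => le_rfl, fun _ _ h => h, fun _ _ h => h, fun _ _ _ x h => ⟨x, h⟩⟩, .inl rfl⟩, by
    simp [start]⟩

end Concurrency

end CFP

/-! ### Validity of the algorithm -/

theorem mainTheorem2 {U : Type*} [Semigroup U] {r : ℕ} (gen : Fin r → U)
    (hgen : Function.Injective gen) (M k : ℕ) (b : WithOne U → Fin k)
    (T : CFP.Snapshot r) (hT : CFP.IsSnapshot gen T) (hB : T.B = ∅) :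
    (∀ β : CFP.Word r → Fin k, ∃ F : Fin k → CFP.Fragment r,
      CFP.IsUnion F T ∧ ∀ j w, w ∈ (F j).Y ↔ w ∈ T.Y ∧ β w = j) ∧
    ∀ F : Fin k → CFP.Fragment r, CFP.IsUnion F T →
      Acc (fun C' C => CFP.Step gen b M C C') (CFP.start F) ∧
      ∀ C : CFP.Config r k, Relation.ReflTransGen (CFP.Step gen b M) (CFP.start F) C →
        CFP.NoConflict C.log ∧
        (∀ j, C.procs j ≠ CFP.Prog.fail) ∧
        (C.phase ≠ CFP.Phase.done → ∃ C', CFP.Step gen b M C C') ∧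
        (C.phase = CFP.Phase.done →
          (∃ T' : CFP.Snapshot r, CFP.IsSnapshot gen T' ∧ T'.B = ∅ ∧
            CFP.IsUnion (CFP.fragments C.mem) T' ∧ T.ExtendsTo T' ∧
            min (M : ℕ∞) (CFP.cardS gen) ≤ (T'.Y.length : ℕ∞)) ∧
          (∀ j, (F j).ExtendsTo (CFP.fragments C.mem j)) ∧
          (CFP.GoodCollection gen F ∨ CFP.fragments C.mem ≠ F →
            CFP.GoodCollection gen (CFP.fragments C.mem))) := by
  refine ⟨CFP.exists_isUnion hT hB, fun F hF => ?_⟩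
  have hstart : CFP.ConfigInv gen b M F (CFP.start F) := CFP.configInv_start hT hF
  refine ⟨hstart.acc, fun C hC => ?_⟩
  have h := hstart.reachable hC
  refine ⟨h.noConflict, h.ne_fail, h.exists_step, fun hp => ?_⟩
  rw [CFP.ConfigInv, hp] at h
  obtain ⟨-, -, h, hM⟩ := h
  replace hM := hM rfl
  refine ⟨?_, CFP.fragment_extendsTo (CFP.inv_initialMem hT hF) h.inv h.ext, fun hgood => ?_⟩
  · obtain ⟨T', hT', hB', hF'⟩ : ∃ T' : CFP.Snapshot r, CFP.IsSnapshot gen T' ∧ T'.B = ∅ ∧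
        CFP.IsUnion (CFP.fragments C.mem) T' := by
      -- If the tuples are those of the input, the snapshot `T` itself serves; otherwise the equal
      -- thresholds provide a new one.
      rcases h.fresh with h1 | h1
      · exact ⟨T, hT, hB, by rwa [h1]⟩
      · exact h1.exists_snapshot
    exact ⟨T', hT', hB', hF', CFP.snapshot_extendsTo hT hF hT' hF' h.ext, h.inv.min_le hM hF'⟩
  · rcases h.fresh with h1 | h1
    · rw [h1]
      exact hgood.resolve_right (not_not_intro h1)
    · exact h1.goodCollection h.one_le
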